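/- **Definitions.** All spaces are complex. A *quantized domain* $\mathcal E=\{H_\alpha\}_{\alpha\in\Gamma}$ is a nonempty upward filtered family of closed subspaces of a Hilbert space $H$ whose union $D=\bigcup_\alpha H_\alpha$ is dense in $H$, and $C_{\mathcal E}(D)$ is the algebra of all linear maps $T:D\to D$ such that, for every $\alpha$, $T(H_\alpha)\subseteq H_\alpha$ and $T|_{H_\alpha}$ is bounded. A (concrete) *local operator space* is a linear subspace $X\subseteq C_{\mathcal E}(D)$ (or a vector space $X$ with an injective linear map into $C_{\mathcal E}(D)$), with the matrix seminorms $\|x\|_\alpha^n=\|x|_{H_\alpha^n}\|$ for $x\in M_n(X)$, $\alpha\in\Gamma$, $n\in\mathbb N$. A family $\{p_\alpha\}$, $p_\alpha=(p_\alpha^n)_n$, on a vector space $V$ is a *separated family of matrix seminorms* (a local operator space structure on $V$) if each $p^n_\alpha$ is a seminorm on $M_n(V)$, $p_\alpha^{m+n}(v\oplus w)=\max\{p_\alpha^m(v),p_\alpha^n(w)\}$, $p_\alpha^n(avb)\le\|a\|\,p_\alpha^m(v)\,\|b\|$ for scalar matrices $a\in M_{n,m}$, $b\in M_{m,n}$,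 and $v=0$ whenever $p_\alpha^1(v)=0$ for all $\alpha$. For a local operator space $X\subseteq C_{\mathcal E}(D)$ let $$S^l_X=\left\{\begin{pmatrix}\lambda I&v\\ w^*&\mu I\end{pmatrix}:\lambda,\mu\in\mathbb C,\ v,w\in X\right\},$$ a $*$-vector space of formal matrices (linear in $\lambda,\mu,v$, conjugate linear in $w$) with involution $\begin{pmatrix}\lambda I&v\\ w^*&\mu I\end{pmatrix}^*=\begin{pmatrix}\bar\lambda I&w\\ v^*&\bar\mu I\end{pmatrix}$ and unit $e_X=\begin{pmatrix}I&0\\0&I\end{pmatrix}$. Let $\mathcal C_\alpha^n(S^l_X)\subseteq M_n(S^l_X)$ be the cone of those hermitian matrices that are positive as operators on $(H_\alpha\oplus H_\alpha)^n$, where the above element acts on $H_\alpha\oplus H_\alpha$ as $\begin{pmatrix}\lambda I&v|_{H_\alpha}\\ (w|_{H_\alpha})^*&\mu I\end{pmatrix}$. The space $X$ is embedded in $S^l_X$ by $x\mapsto\begin{pmatrix}0&x\\0&0\end{pmatrix}$. Let $(V,\{\mathcal C^n_\alpha\},e)$ and $(W,\{\mathcal D^n_\beta\},f)$ be local operator systems.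 The matrix cones of $V\otimes_{\mathrm{lmax}}W$ on the algebraic tensor product $V\otimes W$, indexed by pairs $(\alpha,\beta)$, are the Archimedeanizations $$\mathcal T^{n}_{(\alpha,\beta)}=\{u\in M_n(V\otimes W): r(e\otimes f)_n+u\in\mathcal K^n_{(\alpha,\beta)}\ \text{for all } r>0\},$$ where $\mathcal K^n_{(\alpha,\beta)}=\{a(P\otimes Q)a^*: P\in\mathcal C^k_\alpha,\ Q\in\mathcal D^m_\beta,\ a\in M_{n,km},\ k,m\in\mathbb N\}$ and $(e\otimes f)_n=\mathrm{diag}(e\otimes f,\dots,e\otimes f)$. They determine the matrix seminorms $$\|u\|^n_{(\alpha,\beta)}=\inf\left\{r\ge0:\begin{pmatrix}r(e\otimes f)_n&u\\u^*&r(e\otimes f)_n\end{pmatrix}\in\mathcal T^{2n}_{(\alpha,\beta)}\right\}.$$ For local operator spaces $X$ and $Y$, with matrix seminorms indexed by $\Gamma$ and $\Lambda$, let $X\otimes^{\mathrm{lmax}}Y$ be $X\otimes Y$ with the matrix seminorms $\|\cdot\|^{n,\mathrm{lmax}}_{(\alpha,\beta)}$ obtained by restricting those of $S^l_X\otimes_{\mathrm{lmax}}S^l_Y$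 along the embedding $X\otimes Y\subseteq S^l_X\otimes S^l_Y$. Let $X\otimes_\wedge Y$ be $X\otimes Y$ with the projective matrix seminorms $$\|u\|^{n,\wedge}_{(\alpha,\beta)}=\inf\{\|a\|\,\|x\|^k_\alpha\,\|y\|^m_\beta\,\|b\|: u=a(x\otimes y)b,\ x\in M_k(X),\ y\in M_m(Y),\ a\in M_{n,km},\ b\in M_{km,n},\ k,m\in\mathbb N\}.$$ **Theorem.** Let $X$ and $Y$ be local operator spaces, with matrix seminorms indexed by $\Gamma$ and $\Lambda$. Then $X\otimes^{\mathrm{lmax}}Y$ is a local operator space, i.e. $\{\|\cdot\|^{n,\mathrm{lmax}}_{(\alpha,\beta)}\}$ is a separated family of matrix seminorms on $X\otimes Y$, and it coincides with the local operator space projective tensor product $X\otimes_\wedge Y$: $$\|u\|^{n,\mathrm{lmax}}_{(\alpha,\beta)}=\|u\|^{n,\wedge}_{(\alpha,\beta)}\qquad\text{for all }\alpha\in\Gamma,\ \beta\in\Lambda,\ n\in\mathbb N,\ u\in M_n(X\otimes Y).$$ -/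

import Mathlib

open scoped TensorProduct

noncomputable section

namespace LocalOp

/-! ### Matrices over vector spaces and matrices of operators -/

/-- The product `a M b` of a scalar matrix `a`, a matrix `M` over a complex vector space and a
scalar matrix `b`. -/
def sandwich {l p q r V : Type*} [Fintype p] [Fintype q] [AddCommGroup V] [Module ℂ V]
    (a : Matrix l p ℂ) (M : Matrix p q V) (b : Matrix q r ℂ) : Matrix l r V :=
  fun i j => ∑ s, ∑ t, (a i s * b t j) • M s t

/-- The matrix `x ⊗ y` over `V ⊗ W` whose `((i, j), (k, l))` entry is `x i k ⊗ y j l`. -/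
def tensorMatrix {V W l m p q : Type*} [AddCommGroup V] [Module ℂ V] [AddCommGroup W] [Module ℂ W]
    (x : Matrix l m V) (y : Matrix p q W) : Matrix (l × p) (m × q) (V ⊗[ℂ] W) :=
  Matrix.kroneckerMap (fun v w => v ⊗ₜ[ℂ] w) x y

/-- The `(m + n) × (m + n)` matrix with the four given blocks. -/
def blocks {V : Type*} {m n : ℕ} (A : Matrix (Fin m) (Fin m) V) (B : Matrix (Fin m) (Fin n) V)
    (C : Matrix (Fin n) (Fin m) V) (D : Matrix (Fin n) (Fin n) V) :
    Matrix (Fin (m + n)) (Fin (m + n)) V :=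
  Matrix.reindex finSumFinEquiv finSumFinEquiv (Matrix.fromBlocks A B C D)

/-- A matrix of bounded operators on `K`, as a bounded operator on the Hilbert space direct sum
of copies of `K`. -/
def matrixOp {K ι : Type*} [NormedAddCommGroup K] [InnerProductSpace ℂ K] [Fintype ι]
    (M : Matrix ι ι (K →L[ℂ] K)) :
    PiLp 2 (fun _ : ι => K) →L[ℂ] PiLp 2 (fun _ : ι => K) :=
  (PiLp.continuousLinearEquiv 2 ℂ (fun _ : ι => K)).symm.toContinuousLinearMap ∘L
    (ContinuousLinearMap.pi fun i => ∑ j, M i j ∘L ContinuousLinearMap.proj j) ∘L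
    (PiLp.continuousLinearEquiv 2 ℂ (fun _ : ι => K)).toContinuousLinearMap

theorem matrixOp_apply {K ι : Type*} [NormedAddCommGroup K] [InnerProductSpace ℂ K] [Fintype ι]
    (M : Matrix ι ι (K →L[ℂ] K)) (ξ : PiLp 2 (fun _ : ι => K)) (i : ι) :
    matrixOp M ξ i = ∑ j, M i j (ξ j) := by
  simp [matrixOp]

/-! ### Matrix seminorms, local operator spaces, the projective tensor product -/

/-- A function on `M_n(V)` for each `n`. -/
abbrev MatrixFunctional (V : Type*) := ∀ n : ℕ, Matrix (Fin n) (Fin n) V → ℝ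

open scoped Matrix.Norms.L2Operator in
/-- `p = (p^n)` is a matrix seminorm on `V`: each `p^n` is a seminorm on `M_n(V)`,
`p^{m+n}(v ⊕ w) = max (p^m v) (p^n w)` and `p^n(a v b) ≤ ‖a‖ p^m(v) ‖b‖` for scalar matrices
`a, b` (with their operator norms). -/
structure IsMatrixSeminorm {V : Type*} [AddCommGroup V] [Module ℂ V]
    (p : MatrixFunctional V) : Prop where
  add_le : ∀ (n : ℕ) (v w : Matrix (Fin n) (Fin n) V), p n (v + w) ≤ p n v + p n w
  smul_eq : ∀ (n : ℕ) (c : ℂ) (v : Matrix (Fin n) (Fin n) V), p n (c • v) = ‖c‖ * p n v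
  directSum_eq : ∀ (m n : ℕ) (v : Matrix (Fin m) (Fin m) V) (w : Matrix (Fin n) (Fin n) V),
    p (m + n) (blocks v 0 0 w) = max (p m v) (p n w)
  sandwich_le : ∀ (m n : ℕ) (a : Matrix (Fin n) (Fin m) ℂ) (v : Matrix (Fin m) (Fin m) V)
    (b : Matrix (Fin m) (Fin n) ℂ), p n (sandwich a v b) ≤ ‖a‖ * p m v * ‖b‖

/-- A separated family of matrix seminorms on `V`: a local operator space structure. -/
structure IsLocalOperatorSpace {V Γ : Type*} [AddCommGroup V] [Module ℂ V]
    (p : Γ → MatrixFunctional V) : Prop where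
  isMatrixSeminorm : ∀ α, IsMatrixSeminorm (p α)
  separated : ∀ v : V, (∀ α, p α 1 (fun _ _ => v) = 0) → v = 0

open scoped Matrix.Norms.L2Operator in
/-- The projective matrix seminorm on `V ⊗ W` associated with matrix seminorms `p` on `V` and `q`
on `W`: the infimum of `‖a‖ p(x) q(y) ‖b‖` over all factorizations `u = a (x ⊗ y) b` with
`x ∈ M_k(V)`, `y ∈ M_m(W)` and scalar matrices `a ∈ M_{n,km}`, `b ∈ M_{km,n}`. -/
def projSeminorm {V W : Type*} [AddCommGroup V] [Module ℂ V] [AddCommGroup W] [Module ℂ W]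
    (p : MatrixFunctional V) (q : MatrixFunctional W) : MatrixFunctional (V ⊗[ℂ] W) :=
  fun n u => sInf {c : ℝ | ∃ (k m : ℕ) (a : Matrix (Fin n) (Fin k × Fin m) ℂ)
    (x : Matrix (Fin k) (Fin k) V) (y : Matrix (Fin m) (Fin m) W)
    (b : Matrix (Fin k × Fin m) (Fin n) ℂ),
    u = sandwich a (tensorMatrix x y) b ∧ c = ‖a‖ * p k x * q m y * ‖b‖}

/-! ### Matrix cones, the maximal tensor product, the seminorms of a matrix order -/

/-- A subset of `M_n(V)` for each `n`. -/
abbrev MatrixCone (V : Type*) := ∀ n : ℕ, Set (Matrix (Fin n) (Fin n) V)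

/-- `{a (P ⊗ Q) a* : P ∈ C^k, Q ∈ D^m, a ∈ M_{n,km}, k, m ∈ ℕ}`. -/
def maxPreCone {V W : Type*} [AddCommGroup V] [Module ℂ V] [AddCommGroup W] [Module ℂ W]
    (C : MatrixCone V) (D : MatrixCone W) : MatrixCone (V ⊗[ℂ] W) :=
  fun n => {u | ∃ (k m : ℕ) (P : Matrix (Fin k) (Fin k) V) (Q : Matrix (Fin m) (Fin m) W)
    (a : Matrix (Fin n) (Fin k × Fin m) ℂ),
    P ∈ C k ∧ Q ∈ D m ∧ u = sandwich a (tensorMatrix P Q) a.conjTranspose}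

/-- The Archimedeanization of a matrix cone with respect to `e`:
`{v ∈ M_n(V) : r e_n + v ∈ C^n for all r > 0}`. -/
def archimedeanization {V : Type*} [AddCommGroup V] [Module ℂ V] (e : V) (C : MatrixCone V) :
    MatrixCone V :=
  fun n => {v | ∀ r : ℝ, 0 < r → Matrix.diagonal (fun _ => (r : ℂ) • e) + v ∈ C n}

/-- The matrix cone of the maximal tensor product of `(V, C, e)` and `(W, D, f)` belonging to a
pair of matrix cones `C` on `V` and `D` on `W`. -/
def lmaxCone {V W : Type*} [AddCommGroup V] [Module ℂ V] [AddCommGroup W] [Module ℂ W]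
    (e : V) (f : W) (C : MatrixCone V) (D : MatrixCone W) : MatrixCone (V ⊗[ℂ] W) :=
  archimedeanization (e ⊗ₜ[ℂ] f) (maxPreCone C D)

/-- The matrix seminorm determined by a matrix cone `C` and a matrix order unit `e`:
`‖v‖ = inf {r ≥ 0 : [[r e_n, v], [v*, r e_n]] ∈ C^{2n}}`. -/
def coneSeminorm {V : Type*} [AddCommGroup V] [Module ℂ V] [Star V] (e : V) (C : MatrixCone V) :
    MatrixFunctional V :=
  fun n v => sInf {r : ℝ | 0 ≤ r ∧
    blocks (Matrix.diagonal fun _ => (r : ℂ) • e) v v.conjTranspose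
      (Matrix.diagonal fun _ => (r : ℂ) • e) ∈ C (n + n)}

/-! ### Quantized domains and concrete local operator spaces -/

/-- A quantized domain: an upward filtered family of closed subspaces of a Hilbert space `H`
with dense union. -/
structure QuantizedDomain (Γ H : Type*) [NormedAddCommGroup H] [InnerProductSpace ℂ H] where
  subspace : Γ → Submodule ℂ H
  nonempty : Nonempty Γ
  isClosed : ∀ α, IsClosed (subspace α : Set H)
  directed : Directed (· ≤ ·) subspace
  dense : Dense (⋃ α, (subspace α : Set H))

section Concrete

variable {Γ H : Type*} [NormedAddCommGroup H] [InnerProductSpace ℂ H]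

/-- The union of the subspaces of a quantized domain, as a subspace. -/
def QuantizedDomain.domain (E : QuantizedDomain Γ H) : Submodule ℂ H := ⨆ α, E.subspace α

/-- The supremum defining the domain is a union. -/
theorem QuantizedDomain.mem_domain (E : QuantizedDomain Γ H) (x : H) :
    x ∈ E.domain ↔ ∃ α, x ∈ E.subspace α := by
  have := E.nonempty
  exact Submodule.mem_iSup_of_directed _ E.directed

theorem QuantizedDomain.le_domain (E : QuantizedDomain Γ H) (α : Γ) : E.subspace α ≤ E.domain :=
  le_iSup E.subspace α

/-- The algebra of all noncommutative continuous functions on a quantized domain `E` with union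
`D`: the linear maps `T : D → D` that leave every `H_α` invariant and are bounded on it. -/
def ncFunctions (E : QuantizedDomain Γ H) : Subalgebra ℂ (Module.End ℂ E.domain) where
  carrier := {T | ∀ α, (∀ x : E.domain, (x : H) ∈ E.subspace α → (T x : H) ∈ E.subspace α) ∧
    ∃ c : ℝ, ∀ x : E.domain, (x : H) ∈ E.subspace α → ‖T x‖ ≤ c * ‖x‖}
  mul_mem' := by
    intro S T hS hT α
    refine ⟨fun x hx => (hS α).1 _ ((hT α).1 x hx), ?_⟩
    obtain ⟨c, hc⟩ := (hS α).2
    obtain ⟨d, hd⟩ := (hT α).2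
    refine ⟨|c| * d, fun x hx => ?_⟩
    have h1 := hc (T x) ((hT α).1 x hx)
    have h2 := hd x hx
    calc ‖(S * T) x‖ ≤ c * ‖T x‖ := h1
      _ ≤ |c| * ‖T x‖ := mul_le_mul_of_nonneg_right (le_abs_self c) (norm_nonneg _)
      _ ≤ |c| * (d * ‖x‖) := mul_le_mul_of_nonneg_left h2 (abs_nonneg c)
      _ = |c| * d * ‖x‖ := by ring
  add_mem' := by
    intro S T hS hT α
    refine ⟨fun x hx => (E.subspace α).add_mem ((hS α).1 x hx) ((hT α).1 x hx), ?_⟩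
    obtain ⟨c, hc⟩ := (hS α).2
    obtain ⟨d, hd⟩ := (hT α).2
    refine ⟨c + d, fun x hx => ?_⟩
    calc ‖(S + T) x‖ ≤ ‖S x‖ + ‖T x‖ := norm_add_le _ _
      _ ≤ c * ‖x‖ + d * ‖x‖ := add_le_add (hc x hx) (hd x hx)
      _ = (c + d) * ‖x‖ := by ring
  algebraMap_mem' := by
    intro z α
    refine ⟨fun x hx => (E.subspace α).smul_mem z hx, ‖z‖, fun x _ => ?_⟩
    exact (norm_smul z x).le

/-- The restriction `T|_{H_α}`, a bounded operator on `H_α`. -/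
def restrict (E : QuantizedDomain Γ H) (α : Γ) (T : ncFunctions E) :
    E.subspace α →L[ℂ] E.subspace α :=
  LinearMap.mkContinuousOfExistsBound
    { toFun := fun x => ⟨((T : Module.End ℂ E.domain) ⟨x, E.le_domain α x.2⟩ : E.domain),
        (T.2 α).1 _ x.2⟩
      map_add' := fun x y => Subtype.ext <|
        congrArg (fun z : E.domain => (z : H))
          ((T : Module.End ℂ E.domain).map_add ⟨x, E.le_domain α x.2⟩ ⟨y, E.le_domain α y.2⟩)
      map_smul' := fun c x => Subtype.ext <|
        congrArg (fun z : E.domain => (z : H))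
          ((T : Module.End ℂ E.domain).map_smul c ⟨x, E.le_domain α x.2⟩) }
    (by
      obtain ⟨c, hc⟩ := (T.2 α).2
      exact ⟨c, fun x => hc ⟨x, E.le_domain α x.2⟩ x.2⟩)

theorem restrict_apply (E : QuantizedDomain Γ H) (α : Γ) (T : ncFunctions E)
    (x : E.subspace α) :
    (restrict E α T x : H) =
      ((T : Module.End ℂ E.domain) ⟨x, E.le_domain α x.2⟩ : E.domain) := rfl

/-- The matrix seminorm `p_α` of a concrete local operator space `X ⊆ ncFunctions E` (with
inclusion `ι`): `p_α^n(x)` is the operator norm of `x ∈ M_n(X)` restricted to the direct sum of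
`n` copies of `H_α`. -/
def opSeminorm {E : QuantizedDomain Γ H} {X : Type*} [AddCommGroup X] [Module ℂ X]
    (ι : X →ₗ[ℂ] ncFunctions E) (α : Γ) : MatrixFunctional X :=
  fun _ x => ‖matrixOp (x.map fun v => restrict E α (ι v))‖

end Concrete

/-! ### The local operator system of `2 × 2` operator matrices of a local operator space -/

/-- The underlying space of the local operator system `S^l_X` of a space `X ⊆ ncFunctions E`: the element `⟨a, v, w, d⟩` stands
for the operator matrix `[[a I, v], [w*, d I]]`. -/
@[ext]
structure PaulsenSystem (X : Type*) where
  a : ℂ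
  v : X
  w : X
  d : ℂ

namespace PaulsenSystem

set_option linter.unusedSectionVars false

section

variable {X : Type*} [AddCommGroup X] [Module ℂ X]

instance : Zero (PaulsenSystem X) := ⟨⟨0, 0, 0, 0⟩⟩

instance : Add (PaulsenSystem X) := ⟨fun s t => ⟨s.a + t.a, s.v + t.v, s.w + t.w, s.d + t.d⟩⟩

instance : Neg (PaulsenSystem X) := ⟨fun s => ⟨-s.a, -s.v, -s.w, -s.d⟩⟩

/-- Since `w` stands for `w*`, scalars act on it through their conjugates. -/
instance : SMul ℂ (PaulsenSystem X) := ⟨fun c s => ⟨c * s.a, c • s.v, star c • s.w, c * s.d⟩⟩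

/-- The adjoint of `[[a I, v], [w*, d I]]` is `[[ā I, w], [v*, d̄ I]]`. -/
instance : Star (PaulsenSystem X) := ⟨fun s => ⟨star s.a, s.w, s.v, star s.d⟩⟩

/-- The identity operator. -/
instance : One (PaulsenSystem X) := ⟨⟨1, 0, 0, 1⟩⟩

@[simp] theorem zero_a : (0 : PaulsenSystem X).a = 0 := rfl
@[simp] theorem zero_v : (0 : PaulsenSystem X).v = 0 := rfl
@[simp] theorem zero_w : (0 : PaulsenSystem X).w = 0 := rfl
@[simp] theorem zero_d : (0 : PaulsenSystem X).d = 0 := rfl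
@[simp] theorem add_a (s t : PaulsenSystem X) : (s + t).a = s.a + t.a := rfl
@[simp] theorem add_v (s t : PaulsenSystem X) : (s + t).v = s.v + t.v := rfl
@[simp] theorem add_w (s t : PaulsenSystem X) : (s + t).w = s.w + t.w := rfl
@[simp] theorem add_d (s t : PaulsenSystem X) : (s + t).d = s.d + t.d := rfl
@[simp] theorem neg_a (s : PaulsenSystem X) : (-s).a = -s.a := rfl
@[simp] theorem neg_v (s : PaulsenSystem X) : (-s).v = -s.v := rfl
@[simp] theorem neg_w (s : PaulsenSystem X) : (-s).w = -s.w := rfl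
@[simp] theorem neg_d (s : PaulsenSystem X) : (-s).d = -s.d := rfl
@[simp] theorem smul_a (c : ℂ) (s : PaulsenSystem X) : (c • s).a = c * s.a := rfl
@[simp] theorem smul_v (c : ℂ) (s : PaulsenSystem X) : (c • s).v = c • s.v := rfl
@[simp] theorem smul_w (c : ℂ) (s : PaulsenSystem X) : (c • s).w = star c • s.w := rfl
@[simp] theorem smul_d (c : ℂ) (s : PaulsenSystem X) : (c • s).d = c * s.d := rfl
@[simp] theorem star_a (s : PaulsenSystem X) : (star s).a = star s.a := rfl
@[simp] theorem star_v (s : PaulsenSystem X) : (star s).v = s.w := rfl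
@[simp] theorem star_w (s : PaulsenSystem X) : (star s).w = s.v := rfl
@[simp] theorem star_d (s : PaulsenSystem X) : (star s).d = star s.d := rfl

instance : AddCommGroup (PaulsenSystem X) where
  add_assoc s t u := by ext <;> simp [add_assoc]
  zero_add s := by ext <;> simp
  add_zero s := by ext <;> simp
  add_comm s t := by ext <;> simp [add_comm]
  neg_add_cancel s := by ext <;> simp
  nsmul := nsmulRec
  zsmul := zsmulRec

instance : Module ℂ (PaulsenSystem X) where
  one_smul s := by ext <;> simp
  mul_smul c d s := by ext <;> simp [mul_assoc, mul_smul]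
  smul_zero c := by ext <;> simp
  smul_add c s t := by ext <;> simp [mul_add]
  add_smul c d s := by ext <;> simp [add_mul, add_smul]
  zero_smul s := by ext <;> simp

instance : StarAddMonoid (PaulsenSystem X) where
  star_involutive s := by ext <;> simp
  star_add s t := by ext <;> simp

instance : StarModule ℂ (PaulsenSystem X) where
  star_smul c s := by ext <;> simp

/-- The inclusion `v ↦ [[0, v], [0, 0]]` of `X` into `S^l_X`. -/
def corner : X →ₗ[ℂ] PaulsenSystem X where
  toFun v := ⟨0, v, 0, 0⟩
  map_add' v w := by ext <;> simp
  map_smul' c v := by ext <;> simp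

end

section

variable {Γ H : Type*} [NormedAddCommGroup H] [InnerProductSpace ℂ H] [CompleteSpace H]
  {E : QuantizedDomain Γ H} {X : Type*} [AddCommGroup X] [Module ℂ X]

/-- The operator matrix `[[a I, v], [w*, d I]]` at level `α`, a bounded operator on
`H_α ⊕ H_α`; here `X` is regarded as a subspace of `ncFunctions E` through `ι`. -/
def toOp (ι : X →ₗ[ℂ] ncFunctions E) (α : Γ) (s : PaulsenSystem X) :
    PiLp 2 (fun _ : Fin 2 => E.subspace α) →L[ℂ] PiLp 2 (fun _ : Fin 2 => E.subspace α) :=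
  haveI : CompleteSpace (E.subspace α) := (E.isClosed α).completeSpace_coe
  matrixOp !![s.a • ContinuousLinearMap.id ℂ (E.subspace α), restrict E α (ι s.v);
    ContinuousLinearMap.adjoint (restrict E α (ι s.w)),
    s.d • ContinuousLinearMap.id ℂ (E.subspace α)]

/-- The matrix cone of `S^l_X` at level `α`: the hermitian `P ∈ M_n(S^l_X)` that are positive as
operators on the direct sum of `n` copies of `H_α ⊕ H_α`. -/
def cone (ι : X →ₗ[ℂ] ncFunctions E) (α : Γ) : MatrixCone (PaulsenSystem X) :=
  fun _ => {P | P.IsHermitian ∧ (matrixOp (P.map (toOp ι α))).IsPositive}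

end

end PaulsenSystem

/-! ### The induced tensor product -/

/-- The matrix seminorm indexed by `(α, β)` that `X ⊗ Y` inherits from the maximal local operator
system tensor product of `S^l_X` and `S^l_Y` through the embedding
`x ⊗ y ↦ [[0, x], [0, 0]] ⊗ [[0, y], [0, 0]]`. -/
def inducedLmaxSeminorm {Γ Λ H K X Y : Type*}
    [NormedAddCommGroup H] [InnerProductSpace ℂ H] [CompleteSpace H]
    [NormedAddCommGroup K] [InnerProductSpace ℂ K] [CompleteSpace K]
    [AddCommGroup X] [Module ℂ X] [AddCommGroup Y] [Module ℂ Y]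
    {E : QuantizedDomain Γ H} {F : QuantizedDomain Λ K}
    (ι : X →ₗ[ℂ] ncFunctions E) (κ : Y →ₗ[ℂ] ncFunctions F) (γ : Γ × Λ) :
    MatrixFunctional (X ⊗[ℂ] Y) :=
  fun n u =>
    coneSeminorm ((1 : PaulsenSystem X) ⊗ₜ[ℂ] (1 : PaulsenSystem Y))
      (lmaxCone 1 1 (PaulsenSystem.cone ι γ.1) (PaulsenSystem.cone κ γ.2)) n
      (u.map (TensorProduct.map PaulsenSystem.corner PaulsenSystem.corner))

end LocalOp

end

noncomputable section

namespace LocalOp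

open Matrix
open scoped ComplexOrder

/-! ### Algebra of sandwiches -/

section Sandwich

variable {V W V' W' l m n o p q r s : Type*} [AddCommGroup V] [Module ℂ V] [AddCommGroup W]
  [Module ℂ W] [AddCommGroup V'] [Module ℂ V'] [AddCommGroup W'] [Module ℂ W']

/-! Fix a level (α, β). Both seminorms of u turn out to measure the same thing, namely
factorizations u = a (x ⊗ y) b with contractive x, y and with a aᴴ and bᴴ b both bounded by a
constant r. This is `Factors`. By homogeneity such factorizations exist for every r above the
projective seminorm, and conversely they bound it by r.

From contractions to positivity (`Factors.posFactors_normBlock`): a contraction x makes [[1, x],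
[x*, 1]] positive. Compressing the tensor product of two such blocks by a and bᴴ, placed on the
(1,1) and (2,2) corners, gives [[a aᴴ, u], [u*, bᴴ b]]. Adding the positive scalar matrices r - a aᴴ
and r - bᴴ b completes the diagonal to r.

From positivity to contractions (`PosFactors.factors`): let [[t, u], [u*, t]] = A (P ⊗ Q) Aᴴ and
split A into rows A₁, A₂. Comparing coefficients gives A₁ (P_a ⊗ Q_a) A₁ᴴ = t = A₂ (P_d ⊗ Q_d) A₂ᴴ
and u = A₁ (P_v ⊗ Q_v) A₂ᴴ. By `IsPos.exists_factorization`, P_v = B x C with x contractive, B Bᴴ =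
P_a + δ and Cᴴ C = P_d + δ, and likewise for Q. Hence u = A₁ (B ⊗ B') (x ⊗ y) (C ⊗ C') A₂ᴴ, and as δ
→ 0 the outer factors satisfy the bounds for any s > t. Strict inequalities absorb both δ and the
Archimedeanization.

The seminorm axioms are checked on the projective side. Separation follows because products of
vector functionals are bounded by the projective seminorm and separate the algebraic tensor product.
-/

theorem sandwich_sandwich [Fintype m] [Fintype n] [Fintype p] [Fintype q]
    (c : Matrix l m ℂ) (a : Matrix m n ℂ) (x : Matrix n p V) (b : Matrix p q ℂ)
    (d : Matrix q r ℂ) :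
    sandwich c (sandwich a x b) d = sandwich (c * a) x (b * d) := by
  ext i j
  simp only [sandwich, Matrix.mul_apply, Finset.smul_sum, Finset.sum_mul, Finset.mul_sum,
    Finset.sum_smul, smul_smul]
  simp only [← Fintype.sum_prod_type']
  refine Fintype.sum_equiv
    ⟨fun z => (z.2.2.1, z.2.2.2, z.2.1, z.1), fun w => (w.2.2.2, w.2.2.1, w.1, w.2.1),
      fun _ => rfl, fun _ => rfl⟩ _ _ ?_
  rintro ⟨s, t, u, v⟩
  simp only [Equiv.coe_fn_mk]
  congr 1
  ring

theorem sandwich_map [Fintype m] [Fintype n] (f : V →ₗ[ℂ] W) (a : Matrix l m ℂ)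
    (x : Matrix m n V) (b : Matrix n p ℂ) :
    (sandwich a x b).map f = sandwich a (x.map f) b := by
  ext i j
  simp [sandwich]

theorem sandwich_complex [Fintype m] [Fintype n] (a : Matrix l m ℂ) (x : Matrix m n ℂ)
    (b : Matrix n p ℂ) : sandwich a x b = a * x * b := by
  ext i j
  simp only [sandwich, Matrix.mul_apply, Finset.sum_mul, smul_eq_mul]
  rw [Finset.sum_comm]
  exact Finset.sum_congr rfl fun _ _ => Finset.sum_congr rfl fun _ _ => by ring

theorem sandwich_submatrix {l' m' n' p' : Type*} [Fintype m] [Fintype n] [Fintype m'] [Fintype n']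
    (e : l' → l) (f : m' ≃ m) (g : n' ≃ n) (h : p' → p) (a : Matrix l m ℂ) (x : Matrix m n V)
    (b : Matrix n p ℂ) :
    sandwich (a.submatrix e f) (x.submatrix f g) (b.submatrix g h) =
      (sandwich a x b).submatrix e h := by
  ext i j
  simp only [sandwich, Matrix.submatrix_apply]
  rw [← f.sum_comp]
  exact Finset.sum_congr rfl fun s _ => by rw [← g.sum_comp]

theorem sandwich_rows_cols {l' p' : Type*} [Fintype m] [Fintype n]
    (e : l' → l) (h : p' → p) (a : Matrix l m ℂ) (x : Matrix m n V) (b : Matrix n p ℂ) :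
    sandwich (a.submatrix e id) x (b.submatrix id h) = (sandwich a x b).submatrix e h := rfl

theorem sandwich_smul_smul [Fintype m] [Fintype n] (c d : ℂ) (a : Matrix l m ℂ) (x : Matrix m n V)
    (b : Matrix n p ℂ) : sandwich (c • a) x (d • b) = (c * d) • sandwich a x b := by
  ext i j
  simp only [sandwich, Matrix.smul_apply, Finset.smul_sum, smul_smul, smul_eq_mul]
  exact Finset.sum_congr rfl fun _ _ => Finset.sum_congr rfl fun _ _ => by congr 1; ring

theorem sandwich_smul [Fintype m] [Fintype n] (c : ℂ) (a : Matrix l m ℂ) (x : Matrix m n V)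
    (b : Matrix n p ℂ) : sandwich a (c • x) b = c • sandwich a x b := by
  ext i j
  simp only [sandwich, Matrix.smul_apply, Finset.smul_sum, smul_smul]
  exact Finset.sum_congr rfl fun _ _ => Finset.sum_congr rfl fun _ _ => by congr 1; ring

@[simp] theorem sandwich_one_one [Fintype m] [DecidableEq m] [Fintype n] [DecidableEq n]
    (x : Matrix m n V) : sandwich 1 x 1 = x := by
  ext i j
  simp [sandwich, Matrix.one_apply]

theorem sandwich_fromRows_fromCols [Fintype m] [Fintype n] (a : Matrix l m ℂ) (a' : Matrix o m ℂ)
    (x : Matrix m n V) (b : Matrix n p ℂ) (b' : Matrix n q ℂ) :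
    sandwich (fromRows a a') x (fromCols b b') =
      fromBlocks (sandwich a x b) (sandwich a x b') (sandwich a' x b) (sandwich a' x b') := by
  ext (i | i) (j | j) <;> rfl

@[simp] theorem zero_sandwich [Fintype m] [Fintype n] (x : Matrix m n V) (b : Matrix n p ℂ) :
    sandwich (0 : Matrix l m ℂ) x b = 0 := by
  ext i j
  simp [sandwich]

@[simp] theorem sandwich_zero [Fintype m] [Fintype n] (x : Matrix m n V) (a : Matrix l m ℂ) :
    sandwich a x (0 : Matrix n p ℂ) = 0 := by
  ext i j
  simp [sandwich]

@[simp] theorem sandwich_zero_mid [Fintype m] [Fintype n] (a : Matrix l m ℂ) (b : Matrix n p ℂ) :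
    sandwich a (0 : Matrix m n V) b = 0 := by
  ext i j
  simp [sandwich]

theorem tensorMatrix_map (f : V →ₗ[ℂ] V') (g : W →ₗ[ℂ] W') (x : Matrix l m V) (y : Matrix p q W) :
    (tensorMatrix x y).map (TensorProduct.map f g) = tensorMatrix (x.map f) (y.map g) := by
  ext i j
  simp [tensorMatrix]

/-- The mixed-product rule: scalar factors split off from P and from Q combine into one outer factor
of P ⊗ Q. -/
theorem tensorMatrix_sandwich [Fintype m] [Fintype n] [Fintype q] [Fintype r]
    (a : Matrix l m ℂ) (x : Matrix m n V) (b : Matrix n o ℂ) (c : Matrix p q ℂ)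
    (y : Matrix q r W) (d : Matrix r s ℂ) :
    tensorMatrix (sandwich a x b) (sandwich c y d) =
      sandwich (kroneckerMap (· * ·) a c) (tensorMatrix x y) (kroneckerMap (· * ·) b d) := by
  ext ⟨i, i'⟩ ⟨j, j'⟩
  simp only [tensorMatrix, sandwich, kroneckerMap_apply, TensorProduct.sum_tmul,
    TensorProduct.tmul_sum, TensorProduct.smul_tmul_smul]
  simp only [← Fintype.sum_prod_type']
  refine Fintype.sum_equiv
    ⟨fun z => ((z.2.2.1, z.1), (z.2.2.2, z.2.1)), fun w => (w.1.2, w.2.2, w.1.1, w.2.1),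
      fun _ => rfl, fun _ => rfl⟩ _ _ ?_
  rintro ⟨s, t, u, v⟩
  simp only [Equiv.coe_fn_mk]
  congr 1
  ring

theorem submatrix_eq_sandwich {k : Type*} [Fintype m] [DecidableEq m] (x : Matrix m m V)
    (f : k → m) :
    x.submatrix f f = sandwich ((1 : Matrix m m ℂ).submatrix f id) x
      ((1 : Matrix m m ℂ).submatrix id f) := by
  rw [sandwich_rows_cols, sandwich_one_one]

@[simp] theorem tensorMatrix_zero_zero :
    tensorMatrix (0 : Matrix l m V) (0 : Matrix p q W) = 0 := by
  ext i j
  simp [tensorMatrix]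

theorem smul_tensorMatrix_smul (c d : ℂ) (x : Matrix l m V) (y : Matrix p q W) :
    tensorMatrix (c • x) (d • y) = (c * d) • tensorMatrix x y := by
  ext i j
  simp only [tensorMatrix, kroneckerMap_apply, Matrix.smul_apply, TensorProduct.smul_tmul_smul]

end Sandwich

/-! ### Direct sums inside tensor products -/

section DiagSum

variable {V W l n I J I' J' : Type*} [AddCommGroup V] [Module ℂ V] [AddCommGroup W] [Module ℂ W]

/-- The row matrix `[a, a']`, supported on the diagonal summands of
`(I ⊕ I') × (J ⊕ J')`. -/
def diagRow (a : Matrix n (I × J) ℂ) (a' : Matrix n (I' × J') ℂ) :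
    Matrix n ((I ⊕ I') × (J ⊕ J')) ℂ := fun i z =>
  match z with
  | (Sum.inl s, Sum.inl t) => a i (s, t)
  | (Sum.inr s, Sum.inr t) => a' i (s, t)
  | (Sum.inl _, Sum.inr _) => 0
  | (Sum.inr _, Sum.inl _) => 0

/-- The column matrix corresponding to `diagRow`. -/
def diagCol (b : Matrix (I × J) n ℂ) (b' : Matrix (I' × J') n ℂ) :
    Matrix ((I ⊕ I') × (J ⊕ J')) n ℂ := (diagRow bᵀ b'ᵀ)ᵀ

theorem conjTranspose_diagRow (a : Matrix n (I × J) ℂ) (a' : Matrix n (I' × J') ℂ) :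
    (diagRow a a')ᴴ = diagCol aᴴ a'ᴴ := by
  ext ⟨s | s, t | t⟩ i <;> simp [diagRow, diagCol]

theorem conjTranspose_diagCol (a : Matrix (I × J) n ℂ) (a' : Matrix (I' × J') n ℂ) :
    (diagCol a a')ᴴ = diagRow aᴴ a'ᴴ := by
  ext i ⟨s | s, t | t⟩ <;> simp [diagRow, diagCol]

variable [Fintype I] [Fintype J] [Fintype I'] [Fintype J']

theorem diagRow_mul_diagCol (a : Matrix l (I × J) ℂ) (a' : Matrix l (I' × J') ℂ)
    (b : Matrix (I × J) n ℂ) (b' : Matrix (I' × J') n ℂ) :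
    diagRow a a' * diagCol b b' = a * b + a' * b' := by
  ext i j
  simp [Matrix.mul_apply, Fintype.sum_prod_type, diagRow, diagCol]

/-- Mixed index pairs carry the coefficient 0, so a block of x only ever meets the block of y in the
same position. For block diagonal x and y this yields sums of factorizations; for [[1, x], [x*, 1]]
it places x ⊗ y off the diagonal. -/
theorem sandwich_diagRow_diagCol (a : Matrix l (I × J) ℂ) (a' : Matrix l (I' × J') ℂ)
    (x₁₁ : Matrix I I V) (x₁₂ : Matrix I I' V) (x₂₁ : Matrix I' I V) (x₂₂ : Matrix I' I' V)
    (y₁₁ : Matrix J J W) (y₁₂ : Matrix J J' W) (y₂₁ : Matrix J' J W) (y₂₂ : Matrix J' J' W)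
    (b : Matrix (I × J) n ℂ) (b' : Matrix (I' × J') n ℂ) :
    sandwich (diagRow a a')
      (tensorMatrix (fromBlocks x₁₁ x₁₂ x₂₁ x₂₂) (fromBlocks y₁₁ y₁₂ y₂₁ y₂₂)) (diagCol b b') =
      sandwich a (tensorMatrix x₁₁ y₁₁) b + sandwich a (tensorMatrix x₁₂ y₁₂) b' +
        (sandwich a' (tensorMatrix x₂₁ y₂₁) b + sandwich a' (tensorMatrix x₂₂ y₂₂) b') := by
  ext i j
  simp [sandwich, Fintype.sum_prod_type, diagRow, diagCol, tensorMatrix, Finset.sum_add_distrib]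
  abel

end DiagSum

/-! ### Positive scalar matrices -/

section Scalar

open scoped Matrix.Norms.L2Operator MatrixOrder

variable {m n : Type*} [Fintype m] [Fintype n]

theorem exists_conjTranspose_mul_self {P : Matrix n n ℂ} (hP : P.PosSemidef) :
    ∃ c : Matrix n n ℂ, P = cᴴ * c := by
  classical
  exact CStarAlgebra.nonneg_iff_eq_star_mul_self.1 (Matrix.nonneg_iff_posSemidef.2 hP)

/-- The perturbation by δ makes the square root invertible, so that one can divide by it. -/
theorem PosSemidef.exists_isUnit_of_pos [DecidableEq n] {P : Matrix n n ℂ} (hP : P.PosSemidef)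
    {δ : ℝ} (hδ : 0 < δ) :
    ∃ c : Matrix n n ℂ, P + (δ : ℂ) • 1 = cᴴ * c ∧ IsUnit c := by
  have h : (P + (δ : ℂ) • (1 : Matrix n n ℂ)).PosDef :=
    Matrix.PosDef.posSemidef_add hP (Matrix.PosDef.one.smul (by exact_mod_cast hδ))
  obtain ⟨c, hc⟩ := exists_conjTranspose_mul_self h.posSemidef
  refine ⟨c, hc, ?_⟩
  have hu := h.isUnit
  rw [hc, Matrix.isUnit_iff_isUnit_det, Matrix.det_mul] at hu
  exact (Matrix.isUnit_iff_isUnit_det _).2 (isUnit_of_mul_isUnit_right hu)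

theorem posSemidef_smul_one_sub_iff [DecidableEq n] {P : Matrix n n ℂ} (hP : P.PosSemidef) {r : ℝ}
    (hr : 0 ≤ r) : ((r : ℂ) • (1 : Matrix n n ℂ) - P).PosSemidef ↔ ‖P‖ ≤ r := by
  rw [CStarAlgebra.norm_le_iff_le_algebraMap P hr (Matrix.nonneg_iff_posSemidef.2 hP),
    Matrix.le_iff, Algebra.algebraMap_eq_smul_one]
  simp

theorem posSemidef_sub_mul_conjTranspose_iff [DecidableEq m] [DecidableEq n] (a : Matrix n m ℂ)
    {r : ℝ} (hr : 0 ≤ r) : ((r : ℂ) • (1 : Matrix n n ℂ) - a * aᴴ).PosSemidef ↔ ‖a‖ ^ 2 ≤ r := by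
  rw [posSemidef_smul_one_sub_iff (posSemidef_self_mul_conjTranspose a) hr]
  have := l2_opNorm_conjTranspose_mul_self aᴴ
  rw [conjTranspose_conjTranspose, l2_opNorm_conjTranspose] at this
  rw [this, sq]

theorem posSemidef_sub_conjTranspose_mul_iff [DecidableEq m] [DecidableEq n] (a : Matrix m n ℂ)
    {r : ℝ} (hr : 0 ≤ r) : ((r : ℂ) • (1 : Matrix n n ℂ) - aᴴ * a).PosSemidef ↔ ‖a‖ ^ 2 ≤ r := by
  rw [posSemidef_smul_one_sub_iff (posSemidef_conjTranspose_mul_self a) hr,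
    l2_opNorm_conjTranspose_mul_self, sq]

theorem posSemidef_one_sub_conjTranspose_mul_iff [DecidableEq m] [DecidableEq n]
    (a : Matrix m n ℂ) : (1 - aᴴ * a).PosSemidef ↔ ‖a‖ ≤ 1 := by
  have := posSemidef_sub_conjTranspose_mul_iff a zero_le_one
  rwa [Complex.ofReal_one, one_smul, sq_le_one_iff₀ (norm_nonneg _)] at this

theorem norm_entry_le [DecidableEq n] (a : Matrix m n ℂ) (i : m) (j : n) : ‖a i j‖ ≤ ‖a‖ := by
  have h := l2_opNorm_mulVec a (EuclideanSpace.single j 1)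
  rw [PiLp.norm_single, norm_one, mul_one] at h
  refine le_trans ?_ h
  refine le_trans (le_of_eq ?_) (PiLp.norm_apply_le _ i)
  simp

/-- Only an inequality, since the identity of size zero has norm 0. -/
theorem norm_one_matrix_le [DecidableEq n] : ‖(1 : Matrix n n ℂ)‖ ≤ 1 := by
  rw [← posSemidef_smul_one_sub_iff Matrix.PosSemidef.one zero_le_one]
  simpa using Matrix.PosSemidef.zero

theorem norm_one_submatrix_left_le [DecidableEq m] [DecidableEq n] {f : m → n}
    (hf : Function.Injective f) : ‖(1 : Matrix n n ℂ).submatrix f id‖ ≤ 1 := by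
  rw [← sq_le_one_iff₀ (norm_nonneg _), ← posSemidef_sub_mul_conjTranspose_iff _ zero_le_one,
    conjTranspose_submatrix, ← submatrix_mul _ _ f id f Function.bijective_id]
  simpa [submatrix_one f hf] using Matrix.PosSemidef.zero

theorem norm_one_submatrix_right_le [DecidableEq m] [DecidableEq n] {f : m → n}
    (hf : Function.Injective f) : ‖(1 : Matrix n n ℂ).submatrix id f‖ ≤ 1 := by
  have := l2_opNorm_conjTranspose ((1 : Matrix n n ℂ).submatrix f id)
  rw [conjTranspose_submatrix, conjTranspose_one] at this
  exact this.trans_le (norm_one_submatrix_left_le hf)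

end Scalar

/-! ### Contractive matrices of operators -/

section Contraction

variable {X K I J m n : Type*} [AddCommGroup X] [Module ℂ X] [NormedAddCommGroup K]
  [InnerProductSpace ℂ K]

@[simp] theorem re_ofReal_sq (r : ℝ) : ((r : ℂ) ^ 2).re = r ^ 2 := by
  rw [← Complex.ofReal_pow, Complex.ofReal_re]

/-- This expresses positivity of [[1, T], [T*, 1]] without mentioning an adjoint, so K need not be
complete. -/
theorem norm_le_one_iff_forall_inner {T : K →L[ℂ] K} :
    ‖T‖ ≤ 1 ↔ ∀ ξ η : K, 0 ≤ ‖ξ‖ ^ 2 + ‖η‖ ^ 2 + 2 * (inner ℂ ξ (T η)).re := by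
  constructor
  · intro h ξ η
    have h1 : |(inner ℂ ξ (T η)).re| ≤ ‖ξ‖ * ‖η‖ :=
      calc |(inner ℂ ξ (T η)).re| ≤ ‖inner ℂ ξ (T η)‖ := Complex.abs_re_le_norm _
        _ ≤ ‖ξ‖ * ‖T η‖ := norm_inner_le_norm _ _
        _ ≤ ‖ξ‖ * ‖η‖ := by
          gcongr
          simpa using T.le_of_opNorm_le h η
    nlinarith [neg_abs_le (inner ℂ ξ (T η)).re, sq_nonneg (‖ξ‖ - ‖η‖)]
  · intro h
    refine T.opNorm_le_bound zero_le_one fun η => ?_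
    -- The choice ξ = -Tη turns the form into ‖η‖² - ‖Tη‖².
    have h1 := h (-T η) η
    rw [norm_neg, inner_neg_left, inner_self_eq_norm_sq_to_K] at h1
    rw [one_mul]
    refine le_of_sq_le_sq ?_ (norm_nonneg _)
    have h3 : 0 ≤ ‖T η‖ ^ 2 + ‖η‖ ^ 2 + 2 * (-((‖T η‖ : ℂ) ^ 2)).re := h1
    rw [Complex.neg_re, re_ofReal_sq] at h3
    linarith

/-- A scalar matrix acting on tuples of vectors. -/
def amp [Fintype n] (a : Matrix m n ℂ) (ξ : n → K) : m → K := fun i => ∑ j, a i j • ξ j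

theorem amp_mul [Fintype m] [Fintype n] (a : Matrix I m ℂ) (b : Matrix m n ℂ) (ξ : n → K) :
    amp (a * b) ξ = amp a (amp b ξ) := by
  ext i
  simp only [amp, Matrix.mul_apply, Finset.sum_smul, Finset.smul_sum, smul_smul]
  exact Finset.sum_comm

@[simp] theorem amp_one [Fintype n] [DecidableEq n] (ξ : n → K) :
    amp (1 : Matrix n n ℂ) ξ = ξ := by
  ext i
  simp [amp, Matrix.one_apply]

theorem inner_amp_amp [Fintype m] [Fintype n] (a : Matrix m n ℂ) (ξ : n → K) :
    ∑ i, ∑ j, (aᴴ * a) i j * inner ℂ (ξ i) (ξ j) = ((∑ i, ‖amp a ξ i‖ ^ 2 : ℝ) : ℂ) := by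
  have h : ∀ i, ((‖amp a ξ i‖ ^ 2 : ℝ) : ℂ) =
      ∑ s, ∑ t, star (a i s) * a i t * inner ℂ (ξ s) (ξ t) := by
    intro i
    have : ((‖amp a ξ i‖ ^ 2 : ℝ) : ℂ) = inner ℂ (amp a ξ i) (amp a ξ i) := by
      rw [inner_self_eq_norm_sq_to_K]; simp
    rw [this]
    simp only [amp, sum_inner, inner_sum, inner_smul_left, inner_smul_right, Finset.mul_sum]
    rw [Finset.sum_comm]
    exact Finset.sum_congr rfl fun _ _ => Finset.sum_congr rfl fun _ _ => by
      rw [starRingEnd_apply]; ring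
  rw [Complex.ofReal_sum]
  simp only [h, Matrix.mul_apply, Finset.sum_mul, conjTranspose_apply]
  rw [Finset.sum_comm]
  conv_rhs => rw [Finset.sum_comm]
  rw [Finset.sum_comm]
  exact Finset.sum_congr rfl fun _ _ => Finset.sum_comm

variable (R : X →ₗ[ℂ] (K →L[ℂ] K))

/-- Scalar factors move from the operator matrix onto the vectors, so contractivity of a x b can be
read off from x at transformed vectors. -/
theorem inner_sandwich [Fintype I] [Fintype J] [Fintype m] [Fintype n] (a : Matrix I m ℂ)
    (x : Matrix m n X) (b : Matrix n J ℂ) (ξ : I → K) (η : J → K) :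
    ∑ i, ∑ j, inner ℂ (ξ i) (R (sandwich a x b i j) (η j)) =
      ∑ s, ∑ t, inner ℂ (amp aᴴ ξ s) (R (x s t) (amp b η t)) := by
  simp only [sandwich, amp, map_sum, map_smul, _root_.sum_apply,
    _root_.smul_apply, inner_sum, sum_inner, inner_smul_left, inner_smul_right,
    conjTranspose_apply]
  simp only [← Fintype.sum_prod_type']
  simp only [Finset.mul_sum, ← Fintype.sum_prod_type']
  refine Fintype.sum_equiv
    ⟨fun z => ((z.2.2.1, z.2.2.2, z.2.1), z.1), fun w => (w.2, w.1.2.2, w.1.1, w.1.2.1),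
      fun _ => rfl, fun _ => rfl⟩ _ _ ?_
  rintro ⟨i, j, s, t⟩
  simp only [Equiv.coe_fn_mk, starRingEnd_apply, star_star]
  ring

/-- The matrix of operators given by `x` has norm at most one, in terms of inner products. -/
def IsContr [Fintype I] (x : Matrix I I X) : Prop :=
  ∀ ξ η : I → K, 0 ≤ ∑ i, ‖ξ i‖ ^ 2 + ∑ i, ‖η i‖ ^ 2 +
    2 * (∑ i, ∑ j, inner ℂ (ξ i) (R (x i j) (η j))).re

variable {R}

theorem isContr_iff_norm_le_one [Fintype I] {x : Matrix I I X} :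
    IsContr R x ↔ ‖matrixOp (x.map R)‖ ≤ 1 := by
  rw [norm_le_one_iff_forall_inner]
  have key : ∀ ξ η : PiLp 2 (fun _ : I => K),
      ‖ξ‖ ^ 2 + ‖η‖ ^ 2 + 2 * (inner ℂ ξ (matrixOp (x.map R) η)).re =
        ∑ i, ‖ξ i‖ ^ 2 + ∑ i, ‖η i‖ ^ 2 +
          2 * (∑ i, ∑ j, inner ℂ (ξ i) (R (x i j) (η j))).re := by
    intro ξ η
    rw [PiLp.norm_sq_eq_of_L2, PiLp.norm_sq_eq_of_L2, PiLp.inner_apply]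
    simp [matrixOp_apply, inner_sum]
  constructor
  · intro h ξ η
    rw [key]
    exact h _ _
  · intro h ξ η
    have := h (WithLp.toLp 2 ξ) (WithLp.toLp 2 η)
    rwa [key] at this

theorem IsContr.submatrix [Fintype I] [Fintype J] {x : Matrix I I X} (hx : IsContr R x)
    (e : J ≃ I) : IsContr R (x.submatrix e e) := by
  intro ξ η
  have h := hx (ξ ∘ e.symm) (η ∘ e.symm)
  simp only [← e.sum_comp, Function.comp_apply, e.symm_apply_apply] at h
  exact h

theorem IsContr.fromBlocks [Fintype I] [Fintype J] {x : Matrix I I X} {y : Matrix J J X}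
    (hx : IsContr R x) (hy : IsContr R y) : IsContr R (fromBlocks x 0 0 y) := by
  intro ξ η
  have h1 := hx (ξ ∘ Sum.inl) (η ∘ Sum.inl)
  have h2 := hy (ξ ∘ Sum.inr) (η ∘ Sum.inr)
  simp only [Function.comp_apply] at h1 h2
  simp only [Fintype.sum_sum_type, fromBlocks_apply₁₁, fromBlocks_apply₁₂, fromBlocks_apply₂₁,
    fromBlocks_apply₂₂, Matrix.zero_apply, map_zero, _root_.zero_apply,
    inner_zero_right, Finset.sum_const_zero, add_zero, zero_add, Complex.add_re]
  linarith

theorem matrixOp_smul [Fintype I] (c : ℂ) (M : Matrix I I (K →L[ℂ] K)) :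
    matrixOp (c • M) = c • matrixOp M := by
  ext ξ i
  simp [matrixOp_apply, Finset.smul_sum]

theorem norm_inv_smul_le_one {T : K →L[ℂ] K} {s : ℝ} (hs : 0 < s) (h : ‖T‖ ≤ s) :
    ‖((s⁻¹ : ℝ) : ℂ) • T‖ ≤ 1 := by
  rw [norm_smul, Complex.norm_real, Real.norm_eq_abs, abs_of_pos (inv_pos.2 hs),
    inv_mul_le_iff₀ hs, mul_one]
  exact h

theorem isContr_of_norm_le [Fintype I] {x : Matrix I I X} {s : ℝ} (hs : 0 < s)
    (h : ‖matrixOp (x.map R)‖ ≤ s) : IsContr R (((s⁻¹ : ℝ) : ℂ) • x) := by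
  have e : ((((s⁻¹ : ℝ) : ℂ) • x).map R) = ((s⁻¹ : ℝ) : ℂ) • x.map R := by
    ext i j
    simp
  rw [isContr_iff_norm_le_one, e, matrixOp_smul]
  exact norm_inv_smul_le_one hs h

/-- The two sides differ by δ ∑ ‖ξ i‖², which is nonnegative. -/
theorem re_sum_inner_le [Fintype I] [DecidableEq I] {P c : Matrix I I ℂ} {δ : ℝ} (hδ : 0 ≤ δ)
    (h : P + (δ : ℂ) • 1 = cᴴ * c) (ξ : I → K) :
    (∑ i, ∑ j, P i j * inner ℂ (ξ i) (ξ j)).re ≤ ∑ i, ‖amp c ξ i‖ ^ 2 := by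
  have h1 := congrArg Complex.re (inner_amp_amp c ξ)
  rw [← h, Complex.ofReal_re] at h1
  have h2 : 0 ≤ δ * ∑ i, ‖ξ i‖ ^ 2 := mul_nonneg hδ (Finset.sum_nonneg fun _ _ => sq_nonneg _)
  simp [add_mul, Finset.sum_add_distrib, Matrix.one_apply, ← Finset.mul_sum] at h1 ⊢
  linarith

end Contraction

/-! ### Positive matrices over the operator system -/

section Positive

variable {X K I J : Type*} [AddCommGroup X] [Module ℂ X] [NormedAddCommGroup K]
  [InnerProductSpace ℂ K] (R : X →ₗ[ℂ] (K →L[ℂ] K))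

/-- The quadratic form of a matrix over `S^l_X` evaluated at `ξ ⊕ η`. -/
def quadForm [Fintype I] (P : Matrix I I (PaulsenSystem X)) (ξ η : I → K) : ℝ :=
  (∑ i, ∑ j, (P i j).a * inner ℂ (ξ i) (ξ j)).re +
    2 * (∑ i, ∑ j, inner ℂ (ξ i) (R (P i j).v (η j))).re +
    (∑ i, ∑ j, (P i j).d * inner ℂ (η i) (η j)).re

/-- A hermitian matrix over `S^l_X` with nonnegative quadratic form. -/
def IsPos [Fintype I] (P : Matrix I I (PaulsenSystem X)) : Prop :=
  P.IsHermitian ∧ ∀ ξ η : I → K, 0 ≤ quadForm R P ξ η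

variable {R}

theorem IsPos.submatrix [Fintype I] [Fintype J] {P : Matrix I I (PaulsenSystem X)}
    (hP : IsPos R P) (e : J ≃ I) : IsPos R (P.submatrix e e) := by
  refine ⟨hP.1.submatrix e, fun ξ η => ?_⟩
  have h := hP.2 (ξ ∘ e.symm) (η ∘ e.symm)
  simp only [quadForm, ← e.sum_comp, Function.comp_apply, e.symm_apply_apply] at h
  exact h

theorem IsPos.fromBlocks [Fintype I] [Fintype J] {P : Matrix I I (PaulsenSystem X)}
    {Q : Matrix J J (PaulsenSystem X)} (hP : IsPos R P) (hQ : IsPos R Q) :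
    IsPos R (fromBlocks P 0 0 Q) := by
  refine ⟨hP.1.fromBlocks (by simp) hQ.1, fun ξ η => ?_⟩
  have h1 := hP.2 (ξ ∘ Sum.inl) (η ∘ Sum.inl)
  have h2 := hQ.2 (ξ ∘ Sum.inr) (η ∘ Sum.inr)
  simp only [quadForm, Function.comp_apply] at h1 h2
  simp only [quadForm, Fintype.sum_sum_type, fromBlocks_apply₁₁, fromBlocks_apply₁₂,
    fromBlocks_apply₂₁, fromBlocks_apply₂₂, Matrix.zero_apply, PaulsenSystem.zero_a,
    PaulsenSystem.zero_v, PaulsenSystem.zero_d, map_zero, _root_.zero_apply,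
    inner_zero_right, zero_mul, Finset.sum_const_zero, add_zero, zero_add, Complex.add_re]
  linarith

section

set_option linter.unusedSectionVars false

@[simp] theorem PaulsenSystem.one_a : (1 : PaulsenSystem X).a = 1 := rfl
@[simp] theorem PaulsenSystem.one_v : (1 : PaulsenSystem X).v = 0 := rfl
@[simp] theorem PaulsenSystem.one_w : (1 : PaulsenSystem X).w = 0 := rfl
@[simp] theorem PaulsenSystem.one_d : (1 : PaulsenSystem X).d = 1 := rfl
@[simp] theorem PaulsenSystem.star_one : star (1 : PaulsenSystem X) = 1 := by
  ext <;> simp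
@[simp] theorem PaulsenSystem.corner_a (x : X) : (corner x).a = 0 := rfl
@[simp] theorem PaulsenSystem.corner_v (x : X) : (corner x).v = x := rfl
@[simp] theorem PaulsenSystem.corner_w (x : X) : (corner x).w = 0 := rfl
@[simp] theorem PaulsenSystem.corner_d (x : X) : (corner x).d = 0 := rfl

end

theorem isPos_diagonal_one [Fintype I] [DecidableEq I] :
    IsPos R (diagonal fun _ : I => (1 : PaulsenSystem X)) := by
  refine ⟨isHermitian_diagonal_of_self_adjoint _ (funext fun _ => PaulsenSystem.star_one),
    fun ξ η => ?_⟩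
  simp only [quadForm, diagonal_apply, apply_ite PaulsenSystem.a, apply_ite PaulsenSystem.v,
    apply_ite PaulsenSystem.d]
  simp
  positivity

/-- The matrix `[[1, x], [x*, 1]]` over `S^l_X`. -/
def unitBlock [DecidableEq I] (x : Matrix I I X) : Matrix (I ⊕ I) (I ⊕ I) (PaulsenSystem X) :=
  fromBlocks (diagonal fun _ => 1) (x.map PaulsenSystem.corner)
    (x.map PaulsenSystem.corner)ᴴ (diagonal fun _ => 1)

theorem IsContr.isPos_unitBlock [Fintype I] [DecidableEq I] {x : Matrix I I X}
    (hx : IsContr R x) : IsPos R (unitBlock x) := by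
  have hd := isHermitian_diagonal_of_self_adjoint (fun _ : I => (1 : PaulsenSystem X))
    (funext fun _ => PaulsenSystem.star_one)
  refine ⟨hd.fromBlocks rfl hd, fun ξ η => ?_⟩
  -- The block x couples only the first half of ξ with the second half of η; the other two halves
  -- contribute sums of squares.
  have h := hx (ξ ∘ Sum.inl) (η ∘ Sum.inr)
  have h1 : 0 ≤ ∑ i, ‖ξ (Sum.inr i)‖ ^ 2 := Finset.sum_nonneg fun _ _ => sq_nonneg _
  have h2 : 0 ≤ ∑ i, ‖η (Sum.inl i)‖ ^ 2 := Finset.sum_nonneg fun _ _ => sq_nonneg _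
  simp only [quadForm, unitBlock, Fintype.sum_sum_type, fromBlocks_apply₁₁, fromBlocks_apply₁₂,
    fromBlocks_apply₂₁, fromBlocks_apply₂₂, diagonal_apply, apply_ite PaulsenSystem.a,
    apply_ite PaulsenSystem.v, apply_ite PaulsenSystem.d]
  simp at h ⊢
  linarith

/-- Up to a perturbation of its diagonal part, a positive matrix over `S^l_X` is
`[[BBᴴ, B x C], [*, CᴴC]]` with a contraction `x`. -/
theorem IsPos.exists_factorization [Fintype I] [DecidableEq I] [Nontrivial K]
    {P : Matrix I I (PaulsenSystem X)} (hP : IsPos R P) {δ : ℝ} (hδ : 0 < δ) :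
    ∃ (B C : Matrix I I ℂ) (x : Matrix I I X), IsContr R x ∧
      P.map PaulsenSystem.v = sandwich B x C ∧
      B * Bᴴ = P.map PaulsenSystem.a + (δ : ℂ) • 1 ∧
      Cᴴ * C = P.map PaulsenSystem.d + (δ : ℂ) • 1 := by
  -- Tested on vectors c i • h with h a unit vector, the form reduces to that of the scalar matrix
  -- P_a or P_d. This is where nontriviality of K enters: on the zero space every hermitian P passes
  -- as positive.
  obtain ⟨h, hh⟩ := exists_norm_eq K zero_le_one
  have hinner : ∀ c d : ℂ, inner ℂ (c • h) (d • h) = star c * d := fun c d => by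
    rw [inner_smul_left, inner_smul_right, inner_self_eq_norm_sq_to_K, hh]
    simp
  have ha : (P.map PaulsenSystem.a).PosSemidef := by
    have hH : (P.map PaulsenSystem.a).IsHermitian := by
      ext i j
      have := congrArg PaulsenSystem.a (hP.1.apply i j)
      simpa using this
    refine Matrix.PosSemidef.of_dotProduct_mulVec_nonneg hH fun c => ?_
    rw [Complex.nonneg_iff]
    refine ⟨?_, (hH.im_star_dotProduct_mulVec_self c).symm⟩
    have := hP.2 (fun i => c i • h) 0
    simp [quadForm, hinner] at this
    simpa [dotProduct, mulVec, Finset.mul_sum, mul_left_comm] using this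
  have hd : (P.map PaulsenSystem.d).PosSemidef := by
    have hH : (P.map PaulsenSystem.d).IsHermitian := by
      ext i j
      have := congrArg PaulsenSystem.d (hP.1.apply i j)
      simpa using this
    refine Matrix.PosSemidef.of_dotProduct_mulVec_nonneg hH fun c => ?_
    rw [Complex.nonneg_iff]
    refine ⟨?_, (hH.im_star_dotProduct_mulVec_self c).symm⟩
    have := hP.2 0 (fun i => c i • h)
    simp [quadForm, hinner] at this
    simpa [dotProduct, mulVec, Finset.mul_sum, mul_left_comm] using this
  obtain ⟨b, hb, hbu⟩ := PosSemidef.exists_isUnit_of_pos ha hδ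
  obtain ⟨C, hC, hCu⟩ := PosSemidef.exists_isUnit_of_pos hd hδ
  rw [Matrix.isUnit_iff_isUnit_det] at hbu hCu
  have hb' : IsUnit (bᴴ).det := by rw [det_conjTranspose]; exact hbu.star
  -- The matrix x is P_v divided by both square roots. Its contractivity is positivity of P at the
  -- vectors transformed by the inverse roots, where the perturbed diagonal forms become ‖ξ‖² and
  -- ‖η‖².
  refine ⟨bᴴ, C, sandwich (bᴴ)⁻¹ (P.map PaulsenSystem.v) C⁻¹, fun ξ η => ?_, ?_, ?_, hC.symm⟩
  · rw [inner_sandwich]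
    have h1 := re_sum_inner_le hδ.le hb (amp ((bᴴ)⁻¹)ᴴ ξ)
    have h2 := re_sum_inner_le hδ.le hC (amp C⁻¹ η)
    have hbb : b * ((bᴴ)⁻¹)ᴴ = 1 := by
      rw [← conjTranspose_nonsing_inv, conjTranspose_conjTranspose, mul_nonsing_inv _ hbu]
    rw [← amp_mul, hbb, amp_one] at h1
    rw [← amp_mul, mul_nonsing_inv _ hCu, amp_one] at h2
    have h3 := hP.2 (amp ((bᴴ)⁻¹)ᴴ ξ) (amp C⁻¹ η)
    simp only [quadForm] at h3
    simp only [Matrix.map_apply] at h1 h2 ⊢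
    linarith
  · rw [sandwich_sandwich, mul_nonsing_inv _ hb', nonsing_inv_mul _ hCu, sandwich_one_one]
  · rw [conjTranspose_conjTranspose, hb]

end Positive

/-! ### Contractive factorizations and the projective matrix seminorm -/

section Projective

variable {X Y K K' M N : Type*} [AddCommGroup X] [Module ℂ X] [AddCommGroup Y] [Module ℂ Y]
  [NormedAddCommGroup K] [InnerProductSpace ℂ K] [NormedAddCommGroup K'] [InnerProductSpace ℂ K']

/-- `u = a (x ⊗ y) b` with contractive `x`, `y` and `a aᴴ ≤ S`, `bᴴ b ≤ T`. -/
def Factors (R : X →ₗ[ℂ] (K →L[ℂ] K)) (R' : Y →ₗ[ℂ] (K' →L[ℂ] K')) [Fintype N]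
    (u : Matrix N N (X ⊗[ℂ] Y)) (S T : Matrix N N ℂ) : Prop :=
  ∃ (I J : Type) (_ : Fintype I) (_ : Fintype J) (a : Matrix N (I × J) ℂ) (x : Matrix I I X)
    (y : Matrix J J Y) (b : Matrix (I × J) N ℂ), u = sandwich a (tensorMatrix x y) b ∧
    IsContr R x ∧ IsContr R' y ∧ (S - a * aᴴ).PosSemidef ∧ (T - bᴴ * b).PosSemidef

/-- The matrix seminorm determined by a linear map into bounded operators. -/
def normFunctional (R : X →ₗ[ℂ] (K →L[ℂ] K)) : MatrixFunctional X :=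
  fun _ x => ‖matrixOp (x.map R)‖

variable {R : X →ₗ[ℂ] (K →L[ℂ] K)} {R' : Y →ₗ[ℂ] (K' →L[ℂ] K')} 

/-- Reindexing of an element of the form `a (x ⊗ y) b` by finite ordinals. -/
theorem exists_fin_sandwich {I J : Type} [Fintype I] [Fintype J] (a : Matrix N (I × J) ℂ)
    (x : Matrix I I X) (y : Matrix J J Y) (b : Matrix (I × J) N ℂ) :
    ∃ (e : Fin (Fintype.card I) ≃ I) (f : Fin (Fintype.card J) ≃ J),
      sandwich a (tensorMatrix x y) b =
        LocalOp.sandwich (a.submatrix id (Prod.map e f))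
          (tensorMatrix (x.submatrix e e) (y.submatrix f f))
          (b.submatrix (Prod.map e f) id) := by
  refine ⟨(Fintype.equivFin I).symm, (Fintype.equivFin J).symm, ?_⟩
  have := sandwich_submatrix id
    ((Fintype.equivFin I).symm.prodCongr (Fintype.equivFin J).symm)
    ((Fintype.equivFin I).symm.prodCongr (Fintype.equivFin J).symm) id a (tensorMatrix x y) b
  exact this.symm

/-- `u` is of the form `a (x ⊗ y) b`. -/
def HasFactorization (u : Matrix N N (X ⊗[ℂ] Y)) : Prop :=
  ∃ (I J : Type) (_ : Fintype I) (_ : Fintype J) (a : Matrix N (I × J) ℂ) (x : Matrix I I X)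
    (y : Matrix J J Y) (b : Matrix (I × J) N ℂ), u = sandwich a (tensorMatrix x y) b

theorem HasFactorization.add {u v : Matrix N N (X ⊗[ℂ] Y)} (hu : HasFactorization u)
    (hv : HasFactorization v) : HasFactorization (u + v) := by
  obtain ⟨I, J, _, _, a, x, y, b, rfl⟩ := hu
  obtain ⟨I', J', _, _, a', x', y', b', rfl⟩ := hv
  exact ⟨I ⊕ I', J ⊕ J', inferInstance, inferInstance, diagRow a a', fromBlocks x 0 0 x',
    fromBlocks y 0 0 y', diagCol b b', by simp [sandwich_diagRow_diagCol]⟩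

theorem HasFactorization.zero : HasFactorization (0 : Matrix N N (X ⊗[ℂ] Y)) :=
  ⟨Unit, Unit, inferInstance, inferInstance, 0, 0, 0, 0, by simp⟩

variable [Fintype M] [Fintype N]

/-- Guarantees that the infimum defining `projSeminorm` runs over a nonempty set; a real `sInf` over
the empty set would silently be 0. A single entry x ⊗ y needs only 1 × 1 matrices, and sums use
direct sums. -/
theorem hasFactorization (u : Matrix N N (X ⊗[ℂ] Y)) : HasFactorization u := by
  classical
  induction u using Matrix.induction_on' with
  | h_zero => exact .zero
  | h_add u v hu hv => exact hu.add hv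
  | h_std_basis i j z =>
    induction z using TensorProduct.induction_on with
    | zero => rw [single_zero]; exact .zero
    | add z w hz hw => rw [single_add]; exact hz.add hw
    | tmul x y =>
      refine ⟨Unit, Unit, inferInstance, inferInstance, single i ((), ()) 1, of fun _ _ => x,
        of fun _ _ => y, single ((), ()) j 1, ?_⟩
      ext s t
      by_cases hs : i = s <;> by_cases ht : j = t <;>
        simp [LocalOp.sandwich, tensorMatrix, hs, ht]

/-- For the concatenated row, a aᴴ is replaced by a aᴴ + a' a'ᴴ, and similarly for the column.
Bounding these matrices rather than norms makes the bounds additive, which yields the triangle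
inequality. -/
theorem Factors.add {u u' : Matrix N N (X ⊗[ℂ] Y)} {S T S' T' : Matrix N N ℂ}
    (h : Factors R R' u S T) (h' : Factors R R' u' S' T') :
    Factors R R' (u + u') (S + S') (T + T') := by
  obtain ⟨I, J, _, _, a, x, y, b, hu, hx, hy, ha, hb⟩ := h
  obtain ⟨I', J', _, _, a', x', y', b', hu', hx', hy', ha', hb'⟩ := h'
  refine ⟨I ⊕ I', J ⊕ J', inferInstance, inferInstance, diagRow a a', fromBlocks x 0 0 x',
    fromBlocks y 0 0 y', diagCol b b', ?_, hx.fromBlocks hx', hy.fromBlocks hy', ?_, ?_⟩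
  · simp [sandwich_diagRow_diagCol, hu, hu']
  · rw [conjTranspose_diagRow, diagRow_mul_diagCol, add_sub_add_comm]
    exact ha.add ha'
  · rw [conjTranspose_diagCol, diagRow_mul_diagCol, add_sub_add_comm]
    exact hb.add hb'

theorem Factors.sandwich {u : Matrix N N (X ⊗[ℂ] Y)} {S T : Matrix N N ℂ}
    (h : Factors R R' u S T) (c : Matrix M N ℂ) (d : Matrix N M ℂ) :
    Factors R R' (sandwich c u d) (c * S * cᴴ) (dᴴ * T * d) := by
  obtain ⟨I, J, _, _, a, x, y, b, rfl, hx, hy, ha, hb⟩ := h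
  refine ⟨I, J, inferInstance, inferInstance, c * a, x, y, b * d, sandwich_sandwich _ _ _ _ _,
    hx, hy, ?_, ?_⟩
  · have := ha.mul_mul_conjTranspose_same c
    simpa only [Matrix.mul_sub, Matrix.sub_mul, conjTranspose_mul, Matrix.mul_assoc] using this
  · have := hb.conjTranspose_mul_mul_same d
    simpa only [Matrix.mul_sub, Matrix.sub_mul, conjTranspose_mul, Matrix.mul_assoc] using this

/-- Placed in complementary corners, the bounds c·1 on the two summands add up to c·1 on the whole,
so direct sums produce a maximum and not a sum. -/
theorem Factors.directSum [DecidableEq M] [DecidableEq N] {u : Matrix M M (X ⊗[ℂ] Y)}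
    {v : Matrix N N (X ⊗[ℂ] Y)} {c : ℂ} (hu : Factors R R' u (c • 1) (c • 1))
    (hv : Factors R R' v (c • 1) (c • 1)) :
    Factors R R' (fromBlocks u 0 0 v) (c • 1) (c • 1) := by
  have h1 := hu.sandwich (fromRows 1 0 : Matrix (M ⊕ N) M ℂ) (fromCols 1 0)
  have h2 := hv.sandwich (fromRows 0 1 : Matrix (M ⊕ N) N ℂ) (fromCols 0 1)
  convert h1.add h2 using 1
  · simp [sandwich_fromRows_fromCols, fromBlocks_add]
  · ext (i | i) (j | j) <;>
      simp [conjTranspose_fromRows_eq_fromCols_conjTranspose, one_apply]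
  · ext (i | i) (j | j) <;>
      simp [conjTranspose_fromCols_eq_fromRows_conjTranspose, one_apply]

theorem Factors.submatrix [DecidableEq M] [DecidableEq N] {u : Matrix N N (X ⊗[ℂ] Y)} {c : ℂ}
    (h : Factors R R' u (c • 1) (c • 1)) {f : M → N} (hf : Function.Injective f) :
    Factors R R' (u.submatrix f f) (c • 1) (c • 1) := by
  rw [submatrix_eq_sandwich]
  convert h.sandwich ((1 : Matrix N N ℂ).submatrix f id) ((1 : Matrix N N ℂ).submatrix id f)
    using 1
  all_goals
    rw [conjTranspose_submatrix, conjTranspose_one, Matrix.mul_smul, Matrix.mul_one,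
      Matrix.smul_mul, ← submatrix_mul _ _ f id f Function.bijective_id, Matrix.mul_one,
      submatrix_one f hf]

open scoped Matrix.Norms.L2Operator

theorem projSeminorm_set_nonempty (p : MatrixFunctional X) (q : MatrixFunctional Y) {n : ℕ}
    (u : Matrix (Fin n) (Fin n) (X ⊗[ℂ] Y)) :
    {c : ℝ | ∃ (k m : ℕ) (a : Matrix (Fin n) (Fin k × Fin m) ℂ)
      (x : Matrix (Fin k) (Fin k) X) (y : Matrix (Fin m) (Fin m) Y)
      (b : Matrix (Fin k × Fin m) (Fin n) ℂ),
      u = sandwich a (tensorMatrix x y) b ∧ c = ‖a‖ * p k x * q m y * ‖b‖}.Nonempty := by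
  obtain ⟨I, J, _, _, a, x, y, b, rfl⟩ := hasFactorization u
  obtain ⟨e, f, h⟩ := exists_fin_sandwich a x y b
  exact ⟨_, _, _, _, _, _, _, h, rfl⟩

theorem normFunctional_nonneg {n : ℕ} (x : Matrix (Fin n) (Fin n) X) :
    0 ≤ normFunctional R n x :=
  ContinuousLinearMap.opNorm_nonneg _

theorem projSeminorm_le {n k m : ℕ} (a : Matrix (Fin n) (Fin k × Fin m) ℂ)
    (x : Matrix (Fin k) (Fin k) X) (y : Matrix (Fin m) (Fin m) Y)
    (b : Matrix (Fin k × Fin m) (Fin n) ℂ) :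
    projSeminorm (normFunctional R) (normFunctional R') n (sandwich a (tensorMatrix x y) b) ≤
      ‖a‖ * normFunctional R k x * normFunctional R' m y * ‖b‖ := by
  refine csInf_le ⟨0, ?_⟩ ⟨k, m, a, x, y, b, rfl, rfl⟩
  rintro _ ⟨k, m, a, x, y, b, -, rfl⟩
  have := normFunctional_nonneg (R := R) x
  have := normFunctional_nonneg (R := R') y
  positivity

theorem projSeminorm_nonneg {n : ℕ} (u : Matrix (Fin n) (Fin n) (X ⊗[ℂ] Y)) :
    0 ≤ projSeminorm (normFunctional R) (normFunctional R') n u := by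
  refine Real.sInf_nonneg ?_
  rintro _ ⟨k, m, a, x, y, b, -, rfl⟩
  have := normFunctional_nonneg (R := R) x
  have := normFunctional_nonneg (R := R') y
  positivity

theorem exists_of_projSeminorm_lt {n : ℕ} {u : Matrix (Fin n) (Fin n) (X ⊗[ℂ] Y)} {r : ℝ}
    (h : projSeminorm (normFunctional R) (normFunctional R') n u < r) :
    ∃ (k m : ℕ) (a : Matrix (Fin n) (Fin k × Fin m) ℂ)
      (x : Matrix (Fin k) (Fin k) X) (y : Matrix (Fin m) (Fin m) Y)
      (b : Matrix (Fin k × Fin m) (Fin n) ℂ), u = sandwich a (tensorMatrix x y) b ∧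
      ‖a‖ * normFunctional R k x * normFunctional R' m y * ‖b‖ < r := by
  obtain ⟨_, ⟨k, m, a, x, y, b, hu, rfl⟩, hc⟩ :=
    exists_lt_of_csInf_lt (projSeminorm_set_nonempty _ _ u) h
  exact ⟨k, m, a, x, y, b, hu, hc⟩

/-- The bounds say ‖a‖² ≤ r and ‖b‖² ≤ r, so ‖a‖ ‖b‖ ≤ r by the arithmetic-geometric mean
inequality. -/
theorem Factors.projSeminorm_le {n : ℕ} {u : Matrix (Fin n) (Fin n) (X ⊗[ℂ] Y)} {r : ℝ}
    (hr : 0 ≤ r) (h : Factors R R' u ((r : ℂ) • 1) ((r : ℂ) • 1)) :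
    projSeminorm (normFunctional R) (normFunctional R') n u ≤ r := by
  classical
  obtain ⟨I, J, _, _, a, x, y, b, rfl, hx, hy, ha, hb⟩ := h
  obtain ⟨e, f, h⟩ := exists_fin_sandwich a x y b
  have ha' : ‖a.submatrix id (Prod.map e f)‖ ^ 2 ≤ r := by
    rw [← posSemidef_sub_mul_conjTranspose_iff _ hr, conjTranspose_submatrix]
    have := submatrix_mul_equiv a aᴴ id (e.prodCongr f) id
    rw [show (e.prodCongr f : Fin _ × Fin _ → I × J) = Prod.map e f from rfl] at this
    rw [this]
    simpa using ha
  have hb' : ‖b.submatrix (Prod.map e f) id‖ ^ 2 ≤ r := by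
    rw [← posSemidef_sub_conjTranspose_mul_iff _ hr, conjTranspose_submatrix]
    have := submatrix_mul_equiv bᴴ b id (e.prodCongr f) id
    rw [show (e.prodCongr f : Fin _ × Fin _ → I × J) = Prod.map e f from rfl] at this
    rw [this]
    simpa using hb
  rw [h]
  refine (LocalOp.projSeminorm_le _ _ _ _).trans ?_
  have hx' : normFunctional R _ (x.submatrix e e) ≤ 1 :=
    isContr_iff_norm_le_one.1 (hx.submatrix e)
  have hy' : normFunctional R' _ (y.submatrix f f) ≤ 1 :=
    isContr_iff_norm_le_one.1 (hy.submatrix f)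
  have hx0 := normFunctional_nonneg (R := R) (x.submatrix e e)
  have hy0 := normFunctional_nonneg (R := R') (y.submatrix f f)
  calc _ ≤ ‖a.submatrix id (Prod.map e f)‖ * 1 * 1 * ‖b.submatrix (Prod.map e f) id‖ := by gcongr
    _ ≤ r := by
      rw [mul_one, mul_one]
      have h2 := two_mul_le_add_sq ‖a.submatrix id (Prod.map e f)‖
        ‖b.submatrix (Prod.map e f) id‖
      linarith

theorem factors_of_projSeminorm_lt {n : ℕ} {u : Matrix (Fin n) (Fin n) (X ⊗[ℂ] Y)} {r : ℝ}
    (h : projSeminorm (normFunctional R) (normFunctional R') n u < r) :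
    Factors R R' u ((r : ℂ) • 1) ((r : ℂ) • 1) := by
  have hr : 0 < r := (projSeminorm_nonneg u).trans_lt h
  obtain ⟨k, m, a, x, y, b, rfl, hlt⟩ := exists_of_projSeminorm_lt h
  set p := normFunctional R k x with hp
  set q := normFunctional R' m y with hq
  have hp0 : 0 ≤ p := normFunctional_nonneg x
  have hq0 : 0 ≤ q := normFunctional_nonneg y
  -- Enlarging all four norms by ε permits division even when some of them vanish.
  obtain ⟨ε, hε, hε0⟩ : ∃ ε : ℝ, (‖a‖ + ε) * (p + ε) * (q + ε) * (‖b‖ + ε) < r ∧ 0 < ε := by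
    have hc : ContinuousAt
        (fun ε : ℝ => (‖a‖ + ε) * (p + ε) * (q + ε) * (‖b‖ + ε)) 0 := by fun_prop
    have h1 := hc.eventually_lt continuousAt_const (by simpa using hlt)
    have h2 : ∀ᶠ ε in nhdsWithin (0 : ℝ) (Set.Ioi 0),
        (‖a‖ + ε) * (p + ε) * (q + ε) * (‖b‖ + ε) < r ∧ 0 < ε :=
      (h1.filter_mono nhdsWithin_le_nhds).and self_mem_nhdsWithin
    exact h2.exists
  have hs : 0 < p + ε := by positivity
  have ht : 0 < q + ε := by positivity
  have hA : 0 < ‖a‖ + ε := by positivity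
  have hsr : 0 < √r := Real.sqrt_pos.2 hr
  have hscale : ∀ c : ℝ, 0 ≤ c → ∀ {m' n' : Type} [Fintype m'] [Fintype n'] [DecidableEq n']
      (z : Matrix m' n' ℂ), c * ‖z‖ ≤ √r → ‖(c : ℂ) • z‖ ^ 2 ≤ r := by
    intro c hc m' n' _ _ _ z hz
    rw [norm_smul, Complex.norm_real, Real.norm_eq_abs, abs_of_nonneg hc]
    calc (c * ‖z‖) ^ 2 ≤ √r ^ 2 := by gcongr
      _ = r := Real.sq_sqrt hr.le
  -- The four scalars multiply to 1. They normalise x and y and bring a and b to norm at most √r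
  -- each; for b this uses the bound on the whole product.
  refine ⟨Fin k, Fin m, inferInstance, inferInstance, ((√r / (‖a‖ + ε) : ℝ) : ℂ) • a,
    (((p + ε)⁻¹ : ℝ) : ℂ) • x, (((q + ε)⁻¹ : ℝ) : ℂ) • y,
    (((‖a‖ + ε) * (p + ε) * (q + ε) / √r : ℝ) : ℂ) • b, ?_,
    isContr_of_norm_le hs (by change p ≤ _; linarith),
    isContr_of_norm_le ht (by change q ≤ _; linarith), ?_, ?_⟩
  · rw [smul_tensorMatrix_smul, sandwich_smul_smul, sandwich_smul, smul_smul]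
    norm_cast
    rw [show √r / (‖a‖ + ε) * ((‖a‖ + ε) * (p + ε) * (q + ε) / √r) * ((p + ε)⁻¹ * (q + ε)⁻¹) = 1 by
      field_simp]
    simp
  · rw [posSemidef_sub_mul_conjTranspose_iff _ hr.le]
    refine hscale _ (by positivity) _ ?_
    rw [div_mul_eq_mul_div, div_le_iff₀ hA]
    gcongr
    linarith
  · rw [posSemidef_sub_conjTranspose_mul_iff _ hr.le]
    refine hscale _ (by positivity) _ ?_
    rw [div_mul_eq_mul_div, div_le_iff₀ hsr, Real.mul_self_sqrt hr.le]
    refine le_trans ?_ hε.le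
    gcongr
    linarith

theorem projSeminorm_sandwich_le {m n : ℕ} (c : Matrix (Fin n) (Fin m) ℂ)
    (u : Matrix (Fin m) (Fin m) (X ⊗[ℂ] Y)) (d : Matrix (Fin m) (Fin n) ℂ) :
    projSeminorm (normFunctional R) (normFunctional R') n (sandwich c u d) ≤
      ‖c‖ * projSeminorm (normFunctional R) (normFunctional R') m u * ‖d‖ := by
  have key : ∀ r, projSeminorm (normFunctional R) (normFunctional R') m u < r →
      projSeminorm (normFunctional R) (normFunctional R') n (sandwich c u d) ≤
        ‖c‖ * ‖d‖ * r := by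
    intro r hr
    obtain ⟨k, l, a, x, y, b, rfl, hlt⟩ := exists_of_projSeminorm_lt hr
    rw [sandwich_sandwich]
    refine (projSeminorm_le _ _ _ _).trans ?_
    have hp0 := normFunctional_nonneg (R := R) x
    have hq0 := normFunctional_nonneg (R := R') y
    calc _ ≤ (‖c‖ * ‖a‖) * normFunctional R k x * normFunctional R' l y * (‖b‖ * ‖d‖) := by
          gcongr
          · exact l2_opNorm_mul _ _
          · exact l2_opNorm_mul _ _
      _ = ‖c‖ * ‖d‖ * (‖a‖ * normFunctional R k x * normFunctional R' l y * ‖b‖) := by ring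
      _ ≤ _ := by gcongr
  refine ge_of_tendsto (f := fun r : ℝ => ‖c‖ * ‖d‖ * r)
    (x := nhdsWithin (projSeminorm (normFunctional R) (normFunctional R') m u) (Set.Ioi _)) ?_
    (Filter.eventually_of_mem self_mem_nhdsWithin key)
  rw [mul_right_comm]
  exact (Filter.tendsto_id.const_mul _).mono_left nhdsWithin_le_nhds

theorem projSeminorm_submatrix_le {m n : ℕ} (u : Matrix (Fin m) (Fin m) (X ⊗[ℂ] Y))
    {f : Fin n → Fin m} (hf : Function.Injective f) :
    projSeminorm (normFunctional R) (normFunctional R') n (u.submatrix f f) ≤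
      projSeminorm (normFunctional R) (normFunctional R') m u := by
  rw [submatrix_eq_sandwich]
  refine (projSeminorm_sandwich_le _ _ _).trans ?_
  have h0 := projSeminorm_nonneg (R := R) (R' := R') u
  calc _ ≤ 1 * projSeminorm (normFunctional R) (normFunctional R') m u * 1 := by
        gcongr
        · exact norm_one_submatrix_left_le hf
        · exact norm_one_submatrix_right_le hf
    _ = _ := by ring

theorem isMatrixSeminorm_projSeminorm :
    IsMatrixSeminorm (projSeminorm (normFunctional R) (normFunctional R')) := by
  have hsmul : ∀ (n : ℕ) (c : ℂ) (v : Matrix (Fin n) (Fin n) (X ⊗[ℂ] Y)),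
      projSeminorm (normFunctional R) (normFunctional R') n (c • v) ≤
        ‖c‖ * projSeminorm (normFunctional R) (normFunctional R') n v := by
    intro n c v
    -- Scalar multiplication is a sandwich by c • 1 and 1; the reverse inequality comes later from
    -- applying this to c⁻¹.
    have h := projSeminorm_sandwich_le (R := R) (R' := R') (c • (1 : Matrix (Fin n) (Fin n) ℂ)) v 1
    rw [← one_smul ℂ (1 : Matrix (Fin n) (Fin n) ℂ), smul_smul, sandwich_smul_smul,
      sandwich_one_one, mul_one, mul_one, one_smul, norm_smul] at h
    have h0 := projSeminorm_nonneg (R := R) (R' := R') v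
    calc _ ≤ _ := h
      _ ≤ ‖c‖ * 1 * projSeminorm (normFunctional R) (normFunctional R') n v * 1 := by
        gcongr <;> exact norm_one_matrix_le
      _ = _ := by ring
  refine ⟨fun n v w => ?_, fun n c v => le_antisymm (hsmul n c v) ?_, fun m n v w => ?_,
    fun m n a v b => projSeminorm_sandwich_le a v b⟩
  · refine le_of_forall_pos_le_add fun ε hε => ?_
    have hv := factors_of_projSeminorm_lt (R := R) (R' := R') (u := v) (lt_add_of_pos_right _
      (half_pos hε))
    have hw := factors_of_projSeminorm_lt (R := R) (R' := R') (u := w) (lt_add_of_pos_right _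
      (half_pos hε))
    have h := hv.add hw
    rw [← add_smul, ← Complex.ofReal_add] at h
    have hv0 := projSeminorm_nonneg (R := R) (R' := R') v
    have hw0 := projSeminorm_nonneg (R := R) (R' := R') w
    have := h.projSeminorm_le (by positivity)
    linarith
  · rcases eq_or_ne c 0 with rfl | hc
    · simpa using projSeminorm_nonneg (R := R) (R' := R') _
    · have h := hsmul n c⁻¹ (c • v)
      rw [smul_smul, inv_mul_cancel₀ hc, one_smul, norm_inv] at h
      rwa [← le_inv_mul_iff₀ (norm_pos_iff.2 hc)]
  · refine le_antisymm (le_of_forall_gt_imp_ge_of_dense fun r hr => ?_) (max_le ?_ ?_)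
    · rw [max_lt_iff] at hr
      have h := (factors_of_projSeminorm_lt hr.1).directSum (factors_of_projSeminorm_lt hr.2)
      exact (h.submatrix finSumFinEquiv.symm.injective).projSeminorm_le
        ((projSeminorm_nonneg v).trans hr.1.le)
    -- Each summand is a compression of the direct sum, hence has no larger seminorm.
    · have h := projSeminorm_submatrix_le (R := R) (R' := R') (blocks v 0 0 w)
        (Fin.castAdd_injective m n)
      have e : (blocks v 0 0 w).submatrix (Fin.castAdd n) (Fin.castAdd n) = v := by
        ext i j
        simp [blocks]
      rwa [e] at h
    · have h := projSeminorm_submatrix_le (R := R) (R' := R') (blocks v 0 0 w)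
        (Fin.natAdd_injective n m)
      have e : (blocks v 0 0 w).submatrix (Fin.natAdd m) (Fin.natAdd m) = w := by
        ext i j
        simp [blocks]
      rwa [e] at h

/-- Covers the zero subspaces, to which `IsPos.exists_factorization` does not apply. -/
theorem projSeminorm_eq_zero_of_subsingleton
    (h : Subsingleton K ∨ Subsingleton K') {n : ℕ} (u : Matrix (Fin n) (Fin n) (X ⊗[ℂ] Y)) :
    projSeminorm (normFunctional R) (normFunctional R') n u = 0 := by
  obtain ⟨_, ⟨k, m, a, x, y, b, rfl, -⟩⟩ :=
    projSeminorm_set_nonempty (normFunctional R) (normFunctional R') u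
  refine le_antisymm ((projSeminorm_le _ _ _ _).trans_eq ?_) (projSeminorm_nonneg _)
  rcases h with h | h
  · have : normFunctional R k x = 0 := by
      have : matrixOp (x.map R) = 0 := by
        ext ξ i
        exact Subsingleton.elim _ _
      rw [normFunctional, this]
      exact ContinuousLinearMap.opNorm_zero
    simp [this]
  · have : normFunctional R' m y = 0 := by
      have : matrixOp (y.map R') = 0 := by
        ext ξ i
        exact Subsingleton.elim _ _
      rw [normFunctional, this]
      exact ContinuousLinearMap.opNorm_zero
    simp [this]

end Projective

/-! ### Comparison of the maximal cones with contractive factorizations -/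

section Conj

variable {V W l m n p q : Type*} [AddCommGroup V] [Module ℂ V] [AddCommGroup W] [Module ℂ W]

theorem conjTranspose_sandwich {V : Type*} [AddCommGroup V] [StarAddMonoid V] [Module ℂ V]
    [StarModule ℂ V] [Fintype m] [Fintype n] (a : Matrix l m ℂ) (x : Matrix m n V)
    (b : Matrix n p ℂ) : (sandwich a x b)ᴴ = sandwich bᴴ xᴴ aᴴ := by
  ext i j
  simp only [sandwich, conjTranspose_apply, star_sum, star_smul, star_mul']
  rw [Finset.sum_comm]
  exact Finset.sum_congr rfl fun _ _ => Finset.sum_congr rfl fun _ _ => by rw [mul_comm]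

theorem conjTranspose_tensorMatrix [StarAddMonoid V] [StarModule ℂ V] [StarAddMonoid W]
    [StarModule ℂ W] (x : Matrix l m V) (y : Matrix p q W) :
    (tensorMatrix x y)ᴴ = tensorMatrix xᴴ yᴴ := by
  ext i j
  simp [tensorMatrix, TensorProduct.star_tmul]

theorem sandwich_map_smul [Fintype m] [Fintype n] (a : Matrix l m ℂ) (D : Matrix m n ℂ)
    (b : Matrix n p ℂ) (e : V) :
    sandwich a (D.map fun z => z • e) b = (a * D * b).map fun z => z • e := by
  rw [← sandwich_complex]
  exact (sandwich_map (LinearMap.toSpanSingleton ℂ V e) a D b).symm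

theorem tensorMatrix_diagonal [DecidableEq m] [DecidableEq n] (e : V) (f : W) :
    tensorMatrix (diagonal fun _ : m => e) (diagonal fun _ : n => f) =
      (1 : Matrix (m × n) (m × n) ℂ).map fun z => z • e ⊗ₜ[ℂ] f := by
  ext ⟨i, i'⟩ ⟨j, j'⟩
  by_cases h : i = j <;> by_cases h' : i' = j' <;> simp [tensorMatrix, one_apply, h, h']

theorem diagonal_smul_eq_map [DecidableEq n] (c : ℂ) (e : V) :
    (diagonal fun _ : n => c • e) = (c • (1 : Matrix n n ℂ)).map fun z => z • e := by
  ext i j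
  by_cases h : i = j <;> simp [one_apply, h]

end Conj

/-! ### Passage between positive and contractive factorizations. -/

section Cone

variable {X Y K K' M N : Type*} [AddCommGroup X] [Module ℂ X] [AddCommGroup Y] [Module ℂ Y]
  [NormedAddCommGroup K] [InnerProductSpace ℂ K] [NormedAddCommGroup K'] [InnerProductSpace ℂ K']

/-- `w = a (P ⊗ Q) aᴴ` with positive `P` and `Q` over the operator systems. -/
def PosFactors (R : X →ₗ[ℂ] (K →L[ℂ] K)) (R' : Y →ₗ[ℂ] (K' →L[ℂ] K'))
    (w : Matrix N N (PaulsenSystem X ⊗[ℂ] PaulsenSystem Y)) : Prop :=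
  ∃ (I J : Type) (_ : Fintype I) (_ : Fintype J) (P : Matrix I I (PaulsenSystem X))
    (Q : Matrix J J (PaulsenSystem Y)) (a : Matrix N (I × J) ℂ),
    IsPos R P ∧ IsPos R' Q ∧ w = sandwich a (tensorMatrix P Q) aᴴ

/-- The inclusion of `X ⊗ Y` into `S^l_X ⊗ S^l_Y`. -/
abbrev cornerTensor : X ⊗[ℂ] Y →ₗ[ℂ] PaulsenSystem X ⊗[ℂ] PaulsenSystem Y :=
  TensorProduct.map PaulsenSystem.corner PaulsenSystem.corner

/-- The matrix `[[r, u], [u*, r]]` over `S^l_X ⊗ S^l_Y`. -/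
def normBlock [DecidableEq N] (r : ℝ) (u : Matrix N N (X ⊗[ℂ] Y)) :
    Matrix (N ⊕ N) (N ⊕ N) (PaulsenSystem X ⊗[ℂ] PaulsenSystem Y) :=
  fromBlocks (diagonal fun _ => (r : ℂ) • (1 ⊗ₜ[ℂ] 1)) (u.map cornerTensor)
    (u.map cornerTensor)ᴴ (diagonal fun _ => (r : ℂ) • (1 ⊗ₜ[ℂ] 1))

variable {R : X →ₗ[ℂ] (K →L[ℂ] K)} {R' : Y →ₗ[ℂ] (K' →L[ℂ] K')}

theorem PosFactors.add {w w' : Matrix N N (PaulsenSystem X ⊗[ℂ] PaulsenSystem Y)}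
    (h : PosFactors R R' w) (h' : PosFactors R R' w') : PosFactors R R' (w + w') := by
  obtain ⟨I, J, _, _, P, Q, a, hP, hQ, rfl⟩ := h
  obtain ⟨I', J', _, _, P', Q', a', hP', hQ', rfl⟩ := h'
  refine ⟨I ⊕ I', J ⊕ J', inferInstance, inferInstance, fromBlocks P 0 0 P',
    fromBlocks Q 0 0 Q', diagRow a a', hP.fromBlocks hP', hQ.fromBlocks hQ', ?_⟩
  simp [conjTranspose_diagRow, sandwich_diagRow_diagCol]

theorem PosFactors.sandwich [Fintype N] {w : Matrix N N (PaulsenSystem X ⊗[ℂ] PaulsenSystem Y)}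
    (h : PosFactors R R' w) (c : Matrix M N ℂ) : PosFactors R R' (sandwich c w cᴴ) := by
  obtain ⟨I, J, _, _, P, Q, a, hP, hQ, rfl⟩ := h
  exact ⟨I, J, inferInstance, inferInstance, P, Q, c * a, hP, hQ, by
    rw [sandwich_sandwich, conjTranspose_mul]⟩

theorem posFactors_submatrix_iff 
    {w : Matrix N N (PaulsenSystem X ⊗[ℂ] PaulsenSystem Y)} (e : M ≃ N) :
    PosFactors R R' (w.submatrix e e) ↔ PosFactors R R' w := by
  constructor
  · rintro ⟨I, J, _, _, P, Q, a, hP, hQ, h⟩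
    refine ⟨I, J, inferInstance, inferInstance, P, Q, a.submatrix e.symm id, hP, hQ, ?_⟩
    rw [conjTranspose_submatrix, sandwich_rows_cols, ← h]
    simp
  · rintro ⟨I, J, _, _, P, Q, a, hP, hQ, rfl⟩
    exact ⟨I, J, inferInstance, inferInstance, P, Q, a.submatrix e id, hP, hQ, rfl⟩

/-- Write D = cᴴ c and compress the identity matrix of size N tensored with the 1 × 1 identity. This
supplies the slack terms on the diagonal of `normBlock`. -/
theorem PosFactors.of_posSemidef {N : Type} [Fintype N] {D : Matrix N N ℂ} (hD : D.PosSemidef) :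
    PosFactors R R' (D.map fun z => z • ((1 : PaulsenSystem X) ⊗ₜ[ℂ] (1 : PaulsenSystem Y))) := by
  classical
  obtain ⟨c, rfl⟩ := exists_conjTranspose_mul_self hD
  refine ⟨N, Unit, inferInstance, inferInstance, diagonal fun _ => 1, diagonal fun _ => 1,
    cᴴ.submatrix id Prod.fst, isPos_diagonal_one, isPos_diagonal_one, ?_⟩
  rw [tensorMatrix_diagonal, sandwich_map_smul, Matrix.mul_one, conjTranspose_submatrix,
    conjTranspose_conjTranspose]
  congr 1
  exact (submatrix_mul_equiv cᴴ c id (Equiv.prodPUnit N) id).symm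

theorem Factors.posFactors_normBlock {N : Type} [Fintype N] [DecidableEq N]
    {u : Matrix N N (X ⊗[ℂ] Y)} {r : ℝ} (h : Factors R R' u ((r : ℂ) • 1) ((r : ℂ) • 1)) :
    PosFactors R R' (normBlock r u) := by
  classical
  obtain ⟨I, J, _, _, a, x, y, b, rfl, hx, hy, ha, hb⟩ := h
  -- This element is [[a aᴴ, u], [u*, bᴴ b]], with scalars understood as multiples of 1 ⊗ 1; `h2`
  -- and `h3` fill the diagonal up to r.
  have h1 : PosFactors R R' (LocalOp.sandwich
      (diagRow (fromRows a 0) (fromRows 0 bᴴ) : Matrix (N ⊕ N) _ ℂ)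
      (tensorMatrix (unitBlock x) (unitBlock y)) (diagRow (fromRows a 0) (fromRows 0 bᴴ))ᴴ) :=
    ⟨I ⊕ I, J ⊕ J, inferInstance, inferInstance, _, _, _, hx.isPos_unitBlock,
      hy.isPos_unitBlock, rfl⟩
  have h2 := (PosFactors.of_posSemidef (R := R) (R' := R') ha).sandwich
    (fromRows 1 0 : Matrix (N ⊕ N) N ℂ)
  have h3 := (PosFactors.of_posSemidef (R := R) (R' := R') hb).sandwich
    (fromRows 0 1 : Matrix (N ⊕ N) N ℂ)
  convert (h1.add h2).add h3 using 1
  simp only [unitBlock, conjTranspose_diagRow, sandwich_diagRow_diagCol, tensorMatrix_diagonal,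
    ← conjTranspose_tensorMatrix, ← tensorMatrix_map,
    conjTranspose_fromRows_eq_fromCols_conjTranspose, sandwich_fromRows_fromCols,
    conjTranspose_conjTranspose, conjTranspose_zero, conjTranspose_one, zero_sandwich,
    sandwich_zero, sandwich_map_smul, Matrix.mul_one, Matrix.one_mul, Matrix.zero_mul,
    ← sandwich_map, ← conjTranspose_sandwich, normBlock, fromRows_mul,
    diagonal_smul_eq_map]
  ext (i | i) (j | j) <;> simp [← add_smul]

/-- The upper left scalar coefficient. -/
def coeffA : PaulsenSystem X →ₗ[ℂ] ℂ where
  toFun := PaulsenSystem.a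
  map_add' _ _ := rfl
  map_smul' _ _ := rfl

/-- The lower right scalar coefficient. -/
def coeffD : PaulsenSystem X →ₗ[ℂ] ℂ where
  toFun := PaulsenSystem.d
  map_add' _ _ := rfl
  map_smul' _ _ := rfl

/-- The upper right coefficient. -/
def coeffV : PaulsenSystem X →ₗ[ℂ] X where
  toFun := PaulsenSystem.v
  map_add' _ _ := rfl
  map_smul' _ _ := rfl

/-- The product of two linear functionals on a tensor product. -/
def prodFunctional {V W : Type*} [AddCommGroup V] [Module ℂ V] [AddCommGroup W] [Module ℂ W]
    (f : V →ₗ[ℂ] ℂ) (g : W →ₗ[ℂ] ℂ) : V ⊗[ℂ] W →ₗ[ℂ] ℂ :=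
  LinearMap.mul' ℂ ℂ ∘ₗ TensorProduct.map f g

@[simp] theorem prodFunctional_tmul {V W : Type*} [AddCommGroup V] [Module ℂ V] [AddCommGroup W]
    [Module ℂ W] (f : V →ₗ[ℂ] ℂ) (g : W →ₗ[ℂ] ℂ) (v : V) (w : W) :
    prodFunctional f g (v ⊗ₜ[ℂ] w) = f v * g w := by
  simp [prodFunctional]

theorem sandwich_tensorMatrix_map_prodFunctional {V W l m n p q r : Type*} [AddCommGroup V]
    [Module ℂ V] [AddCommGroup W] [Module ℂ W] [Fintype m] [Fintype n] [Fintype p] [Fintype q]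
    (f : V →ₗ[ℂ] ℂ) (g : W →ₗ[ℂ] ℂ) (a : Matrix l (m × p) ℂ) (x : Matrix m n V)
    (y : Matrix p q W) (b : Matrix (n × q) r ℂ) :
    (sandwich a (tensorMatrix x y) b).map (prodFunctional f g) =
      a * kroneckerMap (· * ·) (x.map f) (y.map g) * b := by
  rw [sandwich_map, sandwich_complex]
  congr 2

open scoped Matrix.Norms.L2Operator in
-- Continuity at δ = 0; it absorbs the perturbation introduced by `IsPos.exists_factorization`.
theorem eventually_norm_perturbation_le {I J : Type*} [Fintype I] [DecidableEq I] [Fintype J]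
    [DecidableEq J] [Fintype N] [DecidableEq N] (a : Matrix N (I × J) ℂ) (S : Matrix I I ℂ)
    (T : Matrix J J ℂ) {t : ℝ} (h : ‖a * kroneckerMap (· * ·) S T * aᴴ‖ < t) :
    ∀ᶠ δ : ℝ in nhdsWithin (0 : ℝ) (Set.Ioi 0),
      ‖a * kroneckerMap (· * ·) (S + (δ : ℂ) • 1) (T + (δ : ℂ) • 1) * aᴴ‖ ≤ t := by
  have hc : Continuous fun δ : ℝ =>
      a * kroneckerMap (· * ·) (S + (δ : ℂ) • 1) (T + (δ : ℂ) • 1) * aᴴ := by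
    refine (continuous_const.matrix_mul ?_).matrix_mul continuous_const
    refine continuous_matrix fun i j => ?_
    simp only [kroneckerMap_apply, Matrix.add_apply, Matrix.smul_apply]
    fun_prop
  have h1 := (hc.norm.tendsto 0).eventually_lt_const (u := t) (by simpa using h)
  exact (h1.filter_mono nhdsWithin_le_nhds).mono fun _ h => h.le

open scoped Matrix.Norms.L2Operator in
theorem PosFactors.factors [Fintype N] [DecidableEq N] [Nontrivial K] [Nontrivial K']
    {u : Matrix N N (X ⊗[ℂ] Y)} {t s : ℝ} (ht : 0 ≤ t) (hts : t < s)
    (h : PosFactors R R' (normBlock t u)) :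
    Factors R R' u ((s : ℂ) • 1) ((s : ℂ) • 1) := by
  classical
  obtain ⟨I, J, _, _, P, Q, A, hP, hQ, hw⟩ := h
  set A₁ := A.submatrix Sum.inl id with hA₁
  set A₂ := A.submatrix Sum.inr id with hA₂
  have e₁ : (diagonal fun _ => (t : ℂ) • (1 ⊗ₜ[ℂ] 1)) = LocalOp.sandwich A₁ (tensorMatrix P Q) A₁ᴴ :=
    congrArg toBlocks₁₁ hw
  have e₂ : (diagonal fun _ => (t : ℂ) • (1 ⊗ₜ[ℂ] 1)) = LocalOp.sandwich A₂ (tensorMatrix P Q) A₂ᴴ :=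
    congrArg toBlocks₂₂ hw
  have e₃ : u.map cornerTensor = LocalOp.sandwich A₁ (tensorMatrix P Q) A₂ᴴ := congrArg toBlocks₁₂ hw
  have hnorm : ‖(t : ℂ) • (1 : Matrix N N ℂ)‖ < s := by
    rw [norm_smul, Complex.norm_real, Real.norm_eq_abs, abs_of_nonneg ht]
    exact (mul_le_of_le_one_right ht norm_one_matrix_le).trans_lt hts
  -- The product functional of the upper left coefficients sends 1 ⊗ 1 to 1, which turns `e₁` into a
  -- scalar identity; the lower right coefficients do the same for `e₂`.
  have f₁ : A₁ * kroneckerMap (· * ·) (P.map coeffA) (Q.map coeffA) * A₁ᴴ = (t : ℂ) • 1 := by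
    rw [← sandwich_tensorMatrix_map_prodFunctional, ← e₁]
    ext i j
    by_cases h : i = j <;> simp [h, coeffA, one_apply]
  have f₂ : A₂ * kroneckerMap (· * ·) (P.map coeffD) (Q.map coeffD) * A₂ᴴ = (t : ℂ) • 1 := by
    rw [← sandwich_tensorMatrix_map_prodFunctional, ← e₂]
    ext i j
    by_cases h : i = j <;> simp [h, coeffD, one_apply]
  -- The tensor square of the upper right coefficient map is a left inverse of `cornerTensor`.
  have f₃ : u = LocalOp.sandwich A₁ (tensorMatrix (P.map coeffV) (Q.map coeffV)) A₂ᴴ := by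
    rw [← tensorMatrix_map, ← sandwich_map, ← e₃]
    ext i j
    have : ∀ z : X ⊗[ℂ] Y, TensorProduct.map coeffV coeffV (cornerTensor z) = z := by
      intro z
      rw [← LinearMap.comp_apply, ← TensorProduct.map_comp]
      exact DFunLike.congr_fun TensorProduct.map_id z
    simp [this]
  obtain ⟨δ, ⟨g₁, g₂⟩, hδ⟩ :=
    (((eventually_norm_perturbation_le A₁ (P.map coeffA) (Q.map coeffA) (t := s)
      (by rw [f₁]; exact hnorm)).and
      (eventually_norm_perturbation_le A₂ (P.map coeffD) (Q.map coeffD) (t := s)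
      (by rw [f₂]; exact hnorm))).and self_mem_nhdsWithin).exists
  obtain ⟨B, C, x, hx, hxv, hB, hC⟩ := hP.exists_factorization hδ
  obtain ⟨B', C', y, hy, hyv, hB', hC'⟩ := hQ.exists_factorization hδ
  refine ⟨I, J, inferInstance, inferInstance, A₁ * kroneckerMap (· * ·) B B', x, y,
    kroneckerMap (· * ·) C C' * A₂ᴴ, ?_, hx, hy, ?_, ?_⟩
  · rw [← sandwich_sandwich, ← tensorMatrix_sandwich, ← hxv, ← hyv]
    exact f₃
  · rw [posSemidef_smul_one_sub_iff (posSemidef_self_mul_conjTranspose _) (ht.trans hts.le)]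
    convert g₁ using 2
    change _ = A₁ * kroneckerMap (· * ·) (P.map PaulsenSystem.a + (δ : ℂ) • 1)
      (Q.map PaulsenSystem.a + (δ : ℂ) • 1) * A₁ᴴ
    rw [← hB, ← hB', mul_kronecker_mul, conjTranspose_mul, conjTranspose_kronecker]
    simp only [Matrix.mul_assoc]
  · rw [posSemidef_smul_one_sub_iff (posSemidef_conjTranspose_mul_self _) (ht.trans hts.le)]
    convert g₂ using 2
    change _ = A₂ * kroneckerMap (· * ·) (P.map PaulsenSystem.d + (δ : ℂ) • 1)
      (Q.map PaulsenSystem.d + (δ : ℂ) • 1) * A₂ᴴ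
    rw [← hC, ← hC', mul_kronecker_mul, conjTranspose_mul, conjTranspose_kronecker,
      conjTranspose_conjTranspose]
    simp only [Matrix.mul_assoc]

end Cone

/-! ### Separation by product functionals -/

section Separation

variable {X Y K K' N : Type*} [AddCommGroup X] [Module ℂ X] [AddCommGroup Y] [Module ℂ Y]
  [NormedAddCommGroup K] [InnerProductSpace ℂ K] [NormedAddCommGroup K'] [InnerProductSpace ℂ K']

/-- The functional `x ↦ ⟪ξ, R x η⟫`. -/
def coefficient (R : X →ₗ[ℂ] (K →L[ℂ] K)) (ξ η : K) : X →ₗ[ℂ] ℂ where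
  toFun x := inner ℂ ξ (R x η)
  map_add' x y := by simp
  map_smul' c x := by simp

open scoped Matrix.Norms.L2Operator

variable {R : X →ₗ[ℂ] (K →L[ℂ] K)} {R' : Y →ₗ[ℂ] (K' →L[ℂ] K')}

/-- Vector functionals are completely contractive: test x on the vectors c i • ξ and d i • η. -/
theorem IsContr.norm_map_coefficient_le {I : Type*} [Fintype I] [DecidableEq I]
    {x : Matrix I I X} (hx : IsContr R x) {ξ η : K} (hξ : ‖ξ‖ ≤ 1) (hη : ‖η‖ ≤ 1) :
    ‖x.map (coefficient R ξ η)‖ ≤ 1 := by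
  rw [← l2_opNorm_toEuclideanCLM, norm_le_one_iff_forall_inner]
  intro c d
  have h := hx (fun i => c i • ξ) (fun i => d i • η)
  have hle : ∀ (c : EuclideanSpace ℂ I) (ξ : K), ‖ξ‖ ≤ 1 → ∑ i, ‖c i • ξ‖ ^ 2 ≤ ‖c‖ ^ 2 := by
    intro c ξ hξ
    rw [EuclideanSpace.norm_sq_eq]
    refine Finset.sum_le_sum fun i _ => ?_
    rw [norm_smul]
    gcongr
    exact mul_le_of_le_one_right (norm_nonneg _) hξ
  have e : ∑ i, ∑ j, inner ℂ (c i • ξ) (R (x i j) (d j • η)) =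
      inner ℂ c (toEuclideanCLM (𝕜 := ℂ) (x.map (coefficient R ξ η)) d) := by
    rw [PiLp.inner_apply]
    refine Finset.sum_congr rfl fun i _ => ?_
    simp only [ofLp_toEuclideanCLM, mulVec, dotProduct, RCLike.inner_apply, Finset.sum_mul,
      Matrix.map_apply, coefficient, LinearMap.coe_mk, AddHom.coe_mk, map_smul, inner_smul_left,
      inner_smul_right]
    exact Finset.sum_congr rfl fun j _ => by ring
  rw [e] at h
  linarith [hle c ξ hξ, hle d η hη]

/-- Rests on 1 - SᴴS ⊗ TᴴT = (1 - SᴴS) ⊗ 1 + SᴴS ⊗ (1 - TᴴT), a sum of positive matrices. -/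
theorem norm_kronecker_le_one {I J : Type*} [Fintype I] [DecidableEq I] [Fintype J]
    [DecidableEq J] {S : Matrix I I ℂ} {T : Matrix J J ℂ} (hS : ‖S‖ ≤ 1) (hT : ‖T‖ ≤ 1) :
    ‖kroneckerMap (· * ·) S T‖ ≤ 1 := by
  rw [← posSemidef_one_sub_conjTranspose_mul_iff] at hS hT ⊢
  have h := (hS.kronecker (Matrix.PosSemidef.one (n := J))).add
    ((posSemidef_conjTranspose_mul_self S).kronecker hT)
  have e : 1 - (kroneckerMap (· * ·) S T)ᴴ * kroneckerMap (· * ·) S T =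
      kroneckerMap (· * ·) (1 - Sᴴ * S) 1 + kroneckerMap (· * ·) (Sᴴ * S) (1 - Tᴴ * T) := by
    rw [conjTranspose_kronecker, ← mul_kronecker_mul, ← one_kronecker_one]
    ext ⟨i, i'⟩ ⟨j, j'⟩
    simp only [Matrix.sub_apply, Matrix.add_apply, kroneckerMap_apply]
    ring
  rw [e]
  exact h

/-- A product of vector functionals turns x ⊗ y into a scalar contraction Z, and an entry of a Z b
is at most ‖a‖ ‖b‖ ≤ r. So a vanishing projective seminorm forces these functionals to vanish. -/
theorem Factors.norm_prodFunctional_le [Fintype N] {u : Matrix N N (X ⊗[ℂ] Y)} [DecidableEq N]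
    {r : ℝ} (hr : 0 ≤ r) (h : Factors R R' u ((r : ℂ) • 1) ((r : ℂ) • 1)) {ξ η : K} {ξ' η' : K'}
    (hξ : ‖ξ‖ ≤ 1) (hη : ‖η‖ ≤ 1) (hξ' : ‖ξ'‖ ≤ 1) (hη' : ‖η'‖ ≤ 1) (i j : N) :
    ‖prodFunctional (coefficient R ξ η) (coefficient R' ξ' η') (u i j)‖ ≤ r := by
  classical
  obtain ⟨I, J, _, _, a, x, y, b, rfl, hx, hy, ha, hb⟩ := h
  rw [posSemidef_sub_mul_conjTranspose_iff _ hr] at ha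
  rw [posSemidef_sub_conjTranspose_mul_iff _ hr] at hb
  set Z := kroneckerMap (· * ·) (x.map (coefficient R ξ η)) (y.map (coefficient R' ξ' η'))
  have hZ : ‖Z‖ ≤ 1 := norm_kronecker_le_one (hx.norm_map_coefficient_le hξ hη)
    (hy.norm_map_coefficient_le hξ' hη')
  have e := congrFun (congrFun (sandwich_tensorMatrix_map_prodFunctional (coefficient R ξ η)
    (coefficient R' ξ' η') a x y b) i) j
  rw [Matrix.map_apply] at e
  rw [e]
  calc _ ≤ ‖a * Z * b‖ := norm_entry_le _ _ _
    _ ≤ ‖a‖ * 1 * ‖b‖ := by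
      refine (l2_opNorm_mul _ _).trans ?_
      gcongr
      exact (l2_opNorm_mul _ _).trans (by gcongr)
    _ ≤ r := by
      rw [mul_one]
      linarith [two_mul_le_add_sq ‖a‖ ‖b‖]

/-- Slice twice. Every slice (f i ⊗ id) z in Y vanishes because the g j separate Y. Expanding z
along a basis of Y, its X-valued coordinates are then killed by every f i, hence are zero. -/
theorem eq_zero_of_forall_prodFunctional {ι κ : Type*} (f : ι → X →ₗ[ℂ] ℂ) (g : κ → Y →ₗ[ℂ] ℂ)
    (hf : ∀ x, (∀ i, f i x = 0) → x = 0) (hg : ∀ y, (∀ j, g j y = 0) → y = 0)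
    {z : X ⊗[ℂ] Y} (hz : ∀ i j, prodFunctional (f i) (g j) z = 0) : z = 0 := by
  classical
  let B := Module.Basis.ofVectorSpace ℂ Y
  have hslice : ∀ (φ : X →ₗ[ℂ] ℂ) (ψ : Y →ₗ[ℂ] ℂ) (z : X ⊗[ℂ] Y),
      ψ (TensorProduct.lid ℂ Y (LinearMap.rTensor Y φ z)) = prodFunctional φ ψ z := by
    intro φ ψ z
    induction z using TensorProduct.induction_on with
    | zero => simp
    | add z w h h' => simp only [map_add, h, h']
    | tmul x y => simp
  have hcoord : ∀ (φ : X →ₗ[ℂ] ℂ) k (z : X ⊗[ℂ] Y),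
      φ (TensorProduct.equivFinsuppOfBasisRight B z k) = prodFunctional φ (B.coord k) z := by
    intro φ k z
    induction z using TensorProduct.induction_on with
    | zero => simp
    | add z w h h' => simp only [map_add, Finsupp.add_apply, h, h']
    | tmul x y => simp [mul_comm]
  have h1 : ∀ i, TensorProduct.lid ℂ Y (LinearMap.rTensor Y (f i) z) = 0 := fun i =>
    hg _ fun j => by rw [hslice, hz]
  rw [← (TensorProduct.equivFinsuppOfBasisRight B).map_eq_zero_iff]
  ext k
  refine hf _ fun i => ?_
  rw [hcoord, ← hslice, h1, map_zero]

end Separation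

/-! ### Concrete local operator spaces -/

section Levels

variable {Γ H X : Type*} [NormedAddCommGroup H] [InnerProductSpace ℂ H]
  {E : QuantizedDomain Γ H} [AddCommGroup X] [Module ℂ X]

/-- The restriction of a concrete local operator space to a level, as a linear map. -/
def levelMap (ι : X →ₗ[ℂ] ncFunctions E) (α : Γ) :
    X →ₗ[ℂ] (E.subspace α →L[ℂ] E.subspace α) where
  toFun x := restrict E α (ι x)
  map_add' x y := by
    ext z
    simp [restrict_apply]
  map_smul' c x := by
    ext z
    simp [restrict_apply]

theorem opSeminorm_eq_normFunctional (ι : X →ₗ[ℂ] ncFunctions E) (α : Γ) :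
    opSeminorm ι α = normFunctional (levelMap ι α) := rfl

theorem eq_zero_of_forall_coefficient {ι : X →ₗ[ℂ] ncFunctions E} (hι : Function.Injective ι)
    {x : X} (h : ∀ (α : Γ) (ξ η : E.subspace α), ‖ξ‖ ≤ 1 → ‖η‖ ≤ 1 →
      coefficient (levelMap ι α) ξ η x = 0) : x = 0 := by
  have hop : ∀ (α : Γ) (η : E.subspace α), levelMap ι α x η = 0 := by
    intro α η
    set ζ := levelMap ι α x η with hζ
    -- Only vectors in the unit ball may be tested, so both are normalised; the convention 0⁻¹ = 0
    -- keeps the bounds valid for zero vectors.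
    have h1 := h α (((‖ζ‖⁻¹ : ℝ) : ℂ) • ζ) (((‖η‖⁻¹ : ℝ) : ℂ) • η)
      (by rw [norm_smul]; simpa using inv_mul_le_one) (by rw [norm_smul]; simpa using inv_mul_le_one)
    simp only [coefficient, LinearMap.coe_mk, AddHom.coe_mk, map_smul, inner_smul_left,
      inner_smul_right, ← hζ, inner_self_eq_norm_sq_to_K] at h1
    by_contra hne
    have hη : η ≠ 0 := by
      rintro rfl
      exact hne (by rw [hζ, map_zero])
    simp [hne, hη] at h1
  apply hι
  rw [map_zero]
  refine Subtype.ext (LinearMap.ext fun z => Subtype.ext ?_)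
  obtain ⟨α, hα⟩ := (E.mem_domain z).1 z.2
  exact congrArg (fun w : E.subspace α => (w : H)) (hop α ⟨z, hα⟩)

variable [CompleteSpace H]

/-- Hermitian symmetry identifies the w entries with the transposed v entries. The two cross terms
are therefore complex conjugates, and the operator's form is the real number `quadForm`. -/
theorem mem_cone_iff (ι : X →ₗ[ℂ] ncFunctions E) (α : Γ) {n : ℕ}
    (P : Matrix (Fin n) (Fin n) (PaulsenSystem X)) :
    P ∈ PaulsenSystem.cone ι α n ↔ IsPos (levelMap ι α) P := by
  have : CompleteSpace (E.subspace α) := (E.isClosed α).completeSpace_coe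
  refine and_congr_right fun hP => ?_
  have ha : ∀ i j, star (P i j).a = (P j i).a := fun i j =>
    congrArg PaulsenSystem.a (hP.apply j i)
  have hd : ∀ i j, star (P i j).d = (P j i).d := fun i j =>
    congrArg PaulsenSystem.d (hP.apply j i)
  have hw : ∀ i j, (P i j).w = (P j i).v := fun i j =>
    congrArg PaulsenSystem.v (hP.apply j i)
  have hself : ∀ (c : Matrix (Fin n) (Fin n) ℂ) (ξ : Fin n → E.subspace α),
      (∀ i j, star (c i j) = c j i) →
      (((∑ i, ∑ j, c i j * inner ℂ (ξ i) (ξ j)).re : ℝ) : ℂ) =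
        ∑ i, ∑ j, c i j * inner ℂ (ξ i) (ξ j) := by
    intro c ξ hc
    rw [← Complex.conj_eq_iff_re, map_sum, Finset.sum_comm]
    simp only [map_sum, map_mul, inner_conj_symm]
    rw [Finset.sum_comm]
    conv_rhs => rw [Finset.sum_comm]
    exact Finset.sum_congr rfl fun i _ => Finset.sum_congr rfl fun j _ => by
      rw [← hc, starRingEnd_apply, star_star]
  have key : ∀ ζ : PiLp 2 (fun _ : Fin n => PiLp 2 (fun _ : Fin 2 => E.subspace α)),
      inner ℂ (matrixOp (P.map (PaulsenSystem.toOp ι α)) ζ) ζ =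
        ((quadForm (levelMap ι α) P (fun i => ζ i 0) (fun i => ζ i 1) : ℝ) : ℂ) := by
    intro ζ
    rw [← inner_conj_symm]
    have h1 : inner ℂ ζ (matrixOp (P.map (PaulsenSystem.toOp ι α)) ζ) =
        ∑ i, ∑ j, (P i j).a * inner ℂ (ζ i 0) (ζ j 0) +
        (∑ i, ∑ j, inner ℂ (ζ i 0) (levelMap ι α (P i j).v (ζ j 1)) +
        star (∑ i, ∑ j, inner ℂ (ζ i 0) (levelMap ι α (P i j).v (ζ j 1)))) +
        ∑ i, ∑ j, (P i j).d * inner ℂ (ζ i 1) (ζ j 1) := by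
      have h2 : star (∑ i, ∑ j, inner ℂ (ζ i 0) (levelMap ι α (P i j).v (ζ j 1))) =
          ∑ i, ∑ j, inner ℂ (levelMap ι α (P i j).w (ζ i 1)) (ζ j 0) := by
        rw [star_sum, Finset.sum_comm]
        simp only [star_sum]
        rw [Finset.sum_comm]
        conv_rhs => rw [Finset.sum_comm]
        exact Finset.sum_congr rfl fun i _ => Finset.sum_congr rfl fun j _ => by
          rw [hw, ← starRingEnd_apply, inner_conj_symm]
      rw [h2]
      simp only [← Finset.sum_add_distrib]
      rw [PiLp.inner_apply]
      refine Finset.sum_congr rfl fun i _ => ?_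
      rw [matrixOp_apply, inner_sum]
      refine Finset.sum_congr rfl fun j _ => ?_
      rw [PiLp.inner_apply, Fin.sum_univ_two, Matrix.map_apply, PaulsenSystem.toOp,
        matrixOp_apply, matrixOp_apply]
      simp only [Fin.sum_univ_two, inner_add_right]
      simp [inner_smul_right, ContinuousLinearMap.adjoint_inner_right, levelMap]
      ring
    rw [h1, ← hself (fun i j => (P i j).a) (fun i => ζ i 0) ha,
      ← hself (fun i j => (P i j).d) (fun i => ζ i 1) hd, ← starRingEnd_apply (R := ℂ),
      Complex.add_conj, quadForm, ← Complex.ofReal_add, ← Complex.ofReal_add, Complex.conj_ofReal]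
  rw [ContinuousLinearMap.isPositive_iff_complex]
  constructor
  · intro h ξ η
    have := (h (WithLp.toLp 2 fun i => WithLp.toLp 2 ![ξ i, η i])).2
    rw [key] at this
    simpa using this
  · intro h ζ
    rw [key]
    exact ⟨by simp, by simpa using h _ _⟩

end Levels

/-! ### The induced maximal seminorm and its identification with the projective one. -/

section Induced

variable {Γ Λ H K X Y : Type*}
  [NormedAddCommGroup H] [InnerProductSpace ℂ H] [NormedAddCommGroup K] [InnerProductSpace ℂ K]
  [AddCommGroup X] [Module ℂ X] [AddCommGroup Y] [Module ℂ Y]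
  {E : QuantizedDomain Γ H} {F : QuantizedDomain Λ K}
  (ι : X →ₗ[ℂ] ncFunctions E) (κ : Y →ₗ[ℂ] ncFunctions F)

theorem eq_zero_of_forall_projSeminorm_eq_zero (hι : Function.Injective ι)
    (hκ : Function.Injective κ) (z : X ⊗[ℂ] Y)
    (h : ∀ (α : Γ) (β : Λ), projSeminorm (opSeminorm ι α) (opSeminorm κ β) 1 (fun _ _ => z) = 0) :
    z = 0 := by
  refine eq_zero_of_forall_prodFunctional
    (ι := {q : Σ α, E.subspace α × E.subspace α // ‖q.2.1‖ ≤ 1 ∧ ‖q.2.2‖ ≤ 1})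
    (κ := {q : Σ β, F.subspace β × F.subspace β // ‖q.2.1‖ ≤ 1 ∧ ‖q.2.2‖ ≤ 1})
    (fun q => coefficient (levelMap ι q.1.1) q.1.2.1 q.1.2.2)
    (fun q => coefficient (levelMap κ q.1.1) q.1.2.1 q.1.2.2)
    (fun x hx => eq_zero_of_forall_coefficient hι fun α ξ η hξ hη =>
      hx ⟨⟨α, ξ, η⟩, hξ, hη⟩)
    (fun y hy => eq_zero_of_forall_coefficient hκ fun β ξ η hξ hη =>
      hy ⟨⟨β, ξ, η⟩, hξ, hη⟩) ?_
  rintro ⟨⟨α, ξ, η⟩, hξ, hη⟩ ⟨⟨β, ξ', η'⟩, hξ', hη'⟩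
  rw [← norm_le_zero_iff]
  refine le_of_forall_gt_imp_ge_of_dense fun r hr => ?_
  have hlt : projSeminorm (normFunctional (levelMap ι α)) (normFunctional (levelMap κ β)) 1
      (fun _ _ => z) < r := (h α β).trans_lt hr
  exact (factors_of_projSeminorm_lt hlt).norm_prodFunctional_le hr.le hξ hη hξ' hη' 0 0

variable [CompleteSpace H] [CompleteSpace K] (α : Γ) (β : Λ)

theorem mem_maxPreCone_iff {n : ℕ}
    (w : Matrix (Fin n) (Fin n) (PaulsenSystem X ⊗[ℂ] PaulsenSystem Y)) :
    w ∈ maxPreCone (PaulsenSystem.cone ι α) (PaulsenSystem.cone κ β) n ↔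
      PosFactors (levelMap ι α) (levelMap κ β) w := by
  constructor
  · rintro ⟨k, m, P, Q, a, hP, hQ, rfl⟩
    exact ⟨Fin k, Fin m, inferInstance, inferInstance, P, Q, a, (mem_cone_iff ι α P).1 hP,
      (mem_cone_iff κ β Q).1 hQ, rfl⟩
  · rintro ⟨I, J, _, _, P, Q, a, hP, hQ, rfl⟩
    obtain ⟨e, f, h⟩ := exists_fin_sandwich a P Q aᴴ
    exact ⟨_, _, _, _, _, (mem_cone_iff ι α _).2 (hP.submatrix e),
      (mem_cone_iff κ β _).2 (hQ.submatrix f), h⟩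

/-- The multiple of the unit added by the Archimedeanization merges with the diagonal r, so
membership becomes a condition on all s > r. -/
theorem mem_lmaxCone_iff {n : ℕ} (u : Matrix (Fin n) (Fin n) (X ⊗[ℂ] Y)) (r : ℝ) :
    blocks (diagonal fun _ => (r : ℂ) • ((1 : PaulsenSystem X) ⊗ₜ[ℂ] (1 : PaulsenSystem Y)))
      (u.map cornerTensor) (u.map cornerTensor)ᴴ
      (diagonal fun _ => (r : ℂ) • ((1 : PaulsenSystem X) ⊗ₜ[ℂ] (1 : PaulsenSystem Y))) ∈
      lmaxCone 1 1 (PaulsenSystem.cone ι α) (PaulsenSystem.cone κ β) (n + n) ↔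
      ∀ s : ℝ, r < s → PosFactors (levelMap ι α) (levelMap κ β) (normBlock s u) := by
  have e : ∀ s : ℝ, diagonal (fun _ : Fin (n + n) =>
        (s : ℂ) • ((1 : PaulsenSystem X) ⊗ₜ[ℂ] (1 : PaulsenSystem Y))) +
      blocks (diagonal fun _ => (r : ℂ) • ((1 : PaulsenSystem X) ⊗ₜ[ℂ] (1 : PaulsenSystem Y)))
      (u.map cornerTensor) (u.map cornerTensor)ᴴ
      (diagonal fun _ => (r : ℂ) • ((1 : PaulsenSystem X) ⊗ₜ[ℂ] (1 : PaulsenSystem Y))) =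
      (normBlock (r + s) u).submatrix finSumFinEquiv.symm finSumFinEquiv.symm := by
    intro s
    ext i j
    obtain ⟨i, rfl⟩ := finSumFinEquiv.surjective i
    obtain ⟨j, rfl⟩ := finSumFinEquiv.surjective j
    simp only [Matrix.add_apply, blocks, reindex_apply, submatrix_apply,
      Equiv.symm_apply_apply, diagonal_apply, EmbeddingLike.apply_eq_iff_eq]
    rcases i with i | i <;> rcases j with j | j <;>
      simp [normBlock, diagonal_apply, add_smul, ite_add_ite, add_comm]
  have h : ∀ s : ℝ, (0 < s → diagonal (fun _ : Fin (n + n) =>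
        (s : ℂ) • ((1 : PaulsenSystem X) ⊗ₜ[ℂ] (1 : PaulsenSystem Y))) +
      blocks (diagonal fun _ => (r : ℂ) • ((1 : PaulsenSystem X) ⊗ₜ[ℂ] (1 : PaulsenSystem Y)))
      (u.map cornerTensor) (u.map cornerTensor)ᴴ
      (diagonal fun _ => (r : ℂ) • ((1 : PaulsenSystem X) ⊗ₜ[ℂ] (1 : PaulsenSystem Y))) ∈
      maxPreCone (PaulsenSystem.cone ι α) (PaulsenSystem.cone κ β) (n + n)) ↔
      (0 < s → PosFactors (levelMap ι α) (levelMap κ β) (normBlock (r + s) u)) := by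
    intro s
    rw [e, mem_maxPreCone_iff, posFactors_submatrix_iff]
  refine (forall_congr' h).trans ⟨fun H s hs => ?_, fun H s hs => H _ (by linarith)⟩
  have := H (s - r) (by linarith)
  rwa [add_sub_cancel] at this

theorem inducedLmaxSeminorm_eq_sInf {n : ℕ} (u : Matrix (Fin n) (Fin n) (X ⊗[ℂ] Y)) :
    inducedLmaxSeminorm ι κ (α, β) n u = sInf {r : ℝ | 0 ≤ r ∧ ∀ s : ℝ, r < s →
      PosFactors (levelMap ι α) (levelMap κ β) (normBlock s u)} :=
  congrArg sInf (Set.ext fun r => and_congr_right fun _ => mem_lmaxCone_iff ι κ α β u r)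

theorem inducedLmaxSeminorm_eq_projSeminorm {n : ℕ} (u : Matrix (Fin n) (Fin n) (X ⊗[ℂ] Y)) :
    inducedLmaxSeminorm ι κ (α, β) n u =
      projSeminorm (opSeminorm ι α) (opSeminorm κ β) n u := by
  rw [inducedLmaxSeminorm_eq_sInf, opSeminorm_eq_normFunctional, opSeminorm_eq_normFunctional]
  have hmem : projSeminorm (normFunctional (levelMap ι α)) (normFunctional (levelMap κ β)) n u ∈
      {r : ℝ | 0 ≤ r ∧ ∀ s : ℝ, r < s →
        PosFactors (levelMap ι α) (levelMap κ β) (normBlock s u)} :=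
    ⟨projSeminorm_nonneg u, fun s hs => (factors_of_projSeminorm_lt hs).posFactors_normBlock⟩
  refine le_antisymm (csInf_le ⟨0, fun r hr => hr.1⟩ hmem) ?_
  -- On a zero subspace the projective seminorm is 0, so the remaining inequality is just
  -- nonnegativity of an infimum.
  rcases subsingleton_or_nontrivial (E.subspace α) with hα | hα
  · rw [projSeminorm_eq_zero_of_subsingleton (.inl hα)]
    exact Real.sInf_nonneg fun r hr => hr.1
  rcases subsingleton_or_nontrivial (F.subspace β) with hβ | hβ
  · rw [projSeminorm_eq_zero_of_subsingleton (.inr hβ)]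
    exact Real.sInf_nonneg fun r hr => hr.1
  refine le_csInf ⟨_, hmem⟩ fun r hr => le_of_forall_gt_imp_ge_of_dense fun s hs => ?_
  -- The gap from r to t is used by the Archimedeanization, the gap from t to s by the perturbation
  -- δ.
  obtain ⟨t, hrt, hts⟩ := exists_between hs
  exact ((hr.2 t hrt).factors (hr.1.trans hrt.le) hts).projSeminorm_le (hr.1.trans hs.le)

end Induced

end LocalOp

end

theorem mainTheorem12 {Γ Λ H K X Y : Type*}
    [NormedAddCommGroup H] [InnerProductSpace ℂ H] [CompleteSpace H]
    [NormedAddCommGroup K] [InnerProductSpace ℂ K] [CompleteSpace K]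
    [AddCommGroup X] [Module ℂ X] [AddCommGroup Y] [Module ℂ Y]
    (E : LocalOp.QuantizedDomain Γ H) (F : LocalOp.QuantizedDomain Λ K)
    (ι : X →ₗ[ℂ] LocalOp.ncFunctions E) (hι : Function.Injective ι)
    (κ : Y →ₗ[ℂ] LocalOp.ncFunctions F) (hκ : Function.Injective κ) :
    LocalOp.IsLocalOperatorSpace (fun γ : Γ × Λ => LocalOp.inducedLmaxSeminorm ι κ γ) ∧
    ∀ (α : Γ) (β : Λ) (n : ℕ) (u : Matrix (Fin n) (Fin n) (TensorProduct ℂ X Y)),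
      LocalOp.inducedLmaxSeminorm ι κ (α, β) n u =
        LocalOp.projSeminorm (LocalOp.opSeminorm ι α) (LocalOp.opSeminorm κ β) n u := by
  have heq : ∀ (α : Γ) (β : Λ), LocalOp.inducedLmaxSeminorm ι κ (α, β) =
      LocalOp.projSeminorm (LocalOp.opSeminorm ι α) (LocalOp.opSeminorm κ β) := fun α β => by
    funext n u
    exact LocalOp.inducedLmaxSeminorm_eq_projSeminorm ι κ α β u
  refine ⟨⟨?_, fun z hz => ?_⟩, fun α β n u => by rw [heq]⟩
  · rintro ⟨α, β⟩
    have h := LocalOp.isMatrixSeminorm_projSeminorm (R := LocalOp.levelMap ι α)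
      (R' := LocalOp.levelMap κ β)
    rw [← LocalOp.opSeminorm_eq_normFunctional, ← LocalOp.opSeminorm_eq_normFunctional,
      ← heq] at h
    exact h
  · exact LocalOp.eq_zero_of_forall_projSeminorm_eq_zero ι κ hι hκ z fun α β => by
      rw [← heq]
      exact hz (α, β)
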